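/- **Setting.** Consider an exponential Jackson network with $K$ nodes, arrival rates $\lambda_k>0$, service rates $\mu_k>0$ and a substochastic routing matrix $P=(p_{kl})$ of spectral radius less than one. Assume that it is ergodic, i.e. that the Markov chain of its queue lengths is positive recurrent. Let $\nu=(I-P^T)^{-1}\lambda$ and $\rho_k=\nu_k/\mu_k$. For $J\subset\{1,\dots,K\}$ let $F_J=\{x\in\mathbb R_+^K: x_i=0 \text{ for } i\in J,\ x_i>0\text{ for } i\notin J\}$. Let $\pi(u)=u\ln u-u+1$ for $u>0$ and $\pi(0)=1$, with the convention that $\pi(x/0)\cdot 0$ is $0$ if $x=0$ and $\infty$ if $x>0$. Let $L(x,y)=\sum_J \mathbf 1_{F_J}(x)L_J(y)$, where $L_J(y)$ is the infimum, over $a,d\in\mathbb R_+^K$ and substochastic matrices $\varrho$ such that $y=a+(\varrho^T-I)d$, of $$\sum_{k}\pi\Bigl(\frac{a_k}{\lambda_k}\Bigr)\lambda_k+\sum_{k\notin J}\pi\Bigl(\frac{d_k}{\mu_k}\Bigr)\mu_k+\sum_{k\in J}\pi\Bigl(\frac{d_k}{\mu_k}\Bigr)\mathbf 1_{\{d_k>\mu_k\}}\mu_k+\sum_k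 d_k\Bigl[\sum_l\pi\Bigl(\frac{\varrho_{kl}}{p_{kl}}\Bigr)p_{kl}+\pi\Bigl(\frac{1-\sum_l\varrho_{kl}}{1-\sum_l p_{kl}}\Bigr)\Bigl(1-\sum_l p_{kl}\Bigr)\Bigr]$$ (with $0\cdot\infty=0$ when $d_k=0$). Let $H_J(\theta)=\sup_y(\theta\cdot y-L_J(y))$, with subdifferential $\partial H_J$. Put $$h_k(\theta)=e^{-\theta_k}\Bigl(\sum_l(e^{\theta_l}-1)p_{kl}+1\Bigr)-1,\qquad H_0(\theta)=\sum_k(e^{\theta_k}-1)\lambda_k+\sum_k h_k(\theta)\mu_k .$$ A path from $0$ to $r$ is a number $T\ge0$ together with an absolutely continuous $q:[0,T]\to\mathbb R_+^K$ with $q(0)=0$ and $q(T)=r$; its cost is $\int_0^T L(q(t),\dot q(t))\,dt$. A path is said to move in $F_J$ with momentum $\theta$ if $\dot q(t)\in\partial H_J(\theta)$ for almost every $t$ with $q(t)\in F_J$. The dual network has arrival rates $\overline\lambda_k=\nu_k(1-\sum_l p_{kl})$, service rates $\mu_k$ and routing matrix $\overline P$ given by $\nu_k\overline p_{kl}=\nu_l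 p_{lk}$. Its fluid trajectory from $r$ is the function $\overline q:\mathbb R_+\to\mathbb R^K_+$ for which there is a componentwise nondecreasing, locally absolutely continuous $\phi$ with $\phi(0)=0$, $\overline q_k(t)\dot\phi_k(t)=0$ for all $k$ and almost every $t$, and $$\overline q(t)=r+\bigl(\overline\lambda-(I-\overline P^T)\mu\bigr)t+(I-\overline P^T)\phi(t),\quad t\ge 0.$$ **Theorem.** (i) For each $m$ there is a unique $\theta^{(m)}\neq0$ with $h_k(\theta^{(m)})=0$ for $k\ne m$ and $H_0(\theta^{(m)})=0$. Let $\theta^*=(\theta^{(1)}_1,\dots,\theta^{(K)}_K)^T$. For each $J$ there is a unique $\tilde\theta^{(J)}$ with $\tilde\theta^{(J)}_k=\theta^*_k$ for $k\notin J$ and $h_k(\tilde\theta^{(J)})=0$ for $k\in J$, and $H_J(\tilde\theta^{(J)})=0$. (ii) Call the face $F_J$ essential if some absolutely continuous trajectory stays in $F_J$ during a time interval of positive length and moves there with momentum $\tilde\theta^{(J)}$. Then $F_J$ is essential if and only if $\tilde\rho^{(J)}_l\ge\rho_l$ for all $l\in J$, where $\tilde\rho^{(J)}_l=e^{-\tilde\theta^{(J)}_l}$.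 (iii) Let $r\in\mathbb R_+^K$. The fluid trajectory $\overline q$ of the dual network from $r$ exists, is unique, and reaches the origin; let $T^*<\infty$ be the first time at which it does. Then $q^*(t)=\overline q(T^*-t)$, $0\le t\le T^*$, is a path from $0$ to $r$ of minimal cost among all paths from $0$ to $r$ (with free duration), and $$\int_0^{T^*}L(q^*(t),\dot q^*(t))\,dt=\theta^*\cdot r .$$ For almost every $t\in[0,T^*]$ the face $F_J$ that contains $q^*(t)$ is essential, and $q^*$ moves in it with momentum $\tilde\theta^{(J)}$. The optimal path is unique up to time spent at the origin: a path $(T,q)$ from $0$ to $r$ has minimal cost if and only if $T\ge T^*$, $q(t)=0$ for $0\le t\le T-T^*$, and $q(t)=q^*(t-(T-T^*))$ for $T-T^*\le t\le T$. -/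

import Mathlib

open MeasureTheory Matrix
open scoped ENNReal

noncomputable section

/-- The data of an (exponential) Jackson network with `K` nodes: arrival rates `lam`, service
rates `mu`, and a substochastic routing matrix `P` whose spectral radius is less than one. -/
structure JacksonNetwork (K : ℕ) where
  lam : Fin K → ℝ
  mu : Fin K → ℝ
  P : Matrix (Fin K) (Fin K) ℝ
  lam_pos : ∀ k, 0 < lam k
  mu_pos : ∀ k, 0 < mu k
  P_nonneg : ∀ k l, 0 ≤ P k l
  P_row_sum_le : ∀ k, ∑ l, P k l ≤ 1
  P_spectralRadius_lt : spectralRadius ℂ (P.map (fun x : ℝ => (x : ℂ))) < 1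

/-- `q` is a fluid trajectory, with initial point `r`, of the network with arrival rates `lam`,
service rates `mu` and routing matrix `P`: it is the oblique reflection of the free motion
`r + t (lam - (I - Pᵀ) mu)` in the nonnegative orthant. The regulator `φ` starts at zero, is
nondecreasing and locally absolutely continuous, and `φ_k` grows only while `q_k = 0`. -/
def IsFluidTrajectory {K : ℕ} (lam mu : Fin K → ℝ) (P : Matrix (Fin K) (Fin K) ℝ)
    (r : Fin K → ℝ) (q : ℝ → Fin K → ℝ) : Prop :=
  ∃ φ : ℝ → Fin K → ℝ,
    φ 0 = 0 ∧
    MonotoneOn φ (Set.Ici 0) ∧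
    (∀ T : ℝ, 0 ≤ T → AbsolutelyContinuousOnInterval φ 0 T) ∧
    (∀ t : ℝ, 0 ≤ t →
      q t = r + t • (lam - (1 - Pᵀ) *ᵥ mu) + (1 - Pᵀ) *ᵥ φ t) ∧
    (∀ t : ℝ, 0 ≤ t → ∀ k, 0 ≤ q t k) ∧
    (∀ k, ∀ᵐ t : ℝ, 0 ≤ t → q t k * deriv (fun s => φ s k) t = 0)

/-- `π(u) = u ln u - u + 1` for `u ≥ 0`; in particular `π(0) = 1`. -/
def entropyFun (u : ℝ) : ℝ := u * Real.log u - u + 1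

/-- The cost `π(x / m) m` for `x, m ≥ 0` of running at rate `x` an event whose nominal rate is `m`,
that is, the Legendre transform of `θ ↦ (e ^ θ - 1) m` at `x`. When `m = 0` it is `0` at `x = 0`
and `∞` at `x > 0`. -/
def rateCost (x m : ℝ) : ℝ≥0∞ :=
  if m = 0 then (if x = 0 then 0 else ⊤) else ENNReal.ofReal (entropyFun (x / m) * m)

/-- Row-substochastic matrices. -/
def IsSubstochastic {K : ℕ} (R : Matrix (Fin K) (Fin K) ℝ) : Prop :=
  (∀ k l, 0 ≤ R k l) ∧ ∀ k, ∑ l, R k l ≤ 1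

/-- The face `F_J` of the nonnegative orthant: `x_i = 0` for `i ∈ J`, `x_i > 0` for `i ∉ J`. -/
def face {K : ℕ} (J : Finset (Fin K)) : Set (Fin K → ℝ) :=
  {x | (∀ i ∈ J, x i = 0) ∧ ∀ i ∉ J, 0 < x i}

/-- `v ∈ ∂f(θ)`, the subdifferential of a convex function `f`. -/
def IsSubgradient {K : ℕ} (f : (Fin K → ℝ) → EReal) (θ v : Fin K → ℝ) : Prop :=
  ∀ θ' : Fin K → ℝ, f θ + ((v ⬝ᵥ (θ' - θ) : ℝ) : EReal) ≤ f θ'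

/-- An absolutely continuous path in the nonnegative orthant from the origin to `r`, which takes
the time `T`. -/
def IsPathTo {K : ℕ} (r : Fin K → ℝ) (T : ℝ) (q : ℝ → Fin K → ℝ) : Prop :=
  0 ≤ T ∧ AbsolutelyContinuousOnInterval q 0 T ∧ q 0 = 0 ∧ q T = r ∧
    ∀ t ∈ Set.Icc 0 T, ∀ k, 0 ≤ q t k

namespace JacksonNetwork

variable {K : ℕ} (N : JacksonNetwork K)

/-- The generator of the Markov chain of queue lengths. An arrival at node `k` comes at rate
`lam k`; a nonempty node `k` serves at rate `mu k`, and a served customer moves to node `l` with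
probability `P k l` or leaves the network with probability `1 - ∑ l, P k l`. -/
def generator (f : (Fin K → ℕ) → ℝ) (x : Fin K → ℕ) : ℝ :=
  ∑ k, N.lam k * (f (x + Pi.single k 1) - f x) +
  ∑ k, if 0 < x k then
      N.mu k * (∑ l, N.P k l * (f (x - Pi.single k 1 + Pi.single l 1) - f x) +
        (1 - ∑ l, N.P k l) * (f (x - Pi.single k 1) - f x))
    else 0

/-- Ergodicity (positive recurrence) of the Markov chain of queue lengths. The chain is irreducible
and has bounded rates, so this is the existence of a stationary probability distribution. -/
def IsErgodic : Prop :=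
  ∃ p : (Fin K → ℕ) → ℝ, (∀ x, 0 ≤ p x) ∧ HasSum p 1 ∧
    ∀ f : (Fin K → ℕ) → ℝ, (∃ C : ℝ, ∀ x, |f x| ≤ C) →
      HasSum (fun x => p x * N.generator f x) 0

/-- The vector of stationary flows `ν = (I - Pᵀ)⁻¹ λ`. -/
def nu : Fin K → ℝ := (1 - N.Pᵀ)⁻¹ *ᵥ N.lam

/-- The loads `ρ_k = ν_k / μ_k`. -/
def rho (k : Fin K) : ℝ := N.nu k / N.mu k

/-- Arrival rates of the dual (time-reversed) network. -/
def dualLam (k : Fin K) : ℝ := N.nu k * (1 - ∑ l, N.P k l)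

/-- Routing matrix of the dual network: `ν_k p̄_{kl} = ν_l p_{lk}`. -/
def dualP : Matrix (Fin K) (Fin K) ℝ := Matrix.of fun k l => N.nu l * N.P l k / N.nu k

/-- Fluid trajectories, from `r`, of the dual network (its service rates are those of `N`). -/
def IsDualFluid (r : Fin K → ℝ) (q : ℝ → Fin K → ℝ) : Prop :=
  IsFluidTrajectory N.dualLam N.mu N.dualP r q

/-- The cost `ψ_J(a, d, R)` on the face `F_J` of arrival rates `a`, departure rates `d` and
routing `R`. -/
def psi (J : Finset (Fin K)) (a d : Fin K → ℝ) (R : Matrix (Fin K) (Fin K) ℝ) : ℝ≥0∞ :=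
  ∑ k, rateCost (a k) (N.lam k) +
  ∑ k ∈ Jᶜ, rateCost (d k) (N.mu k) +
  ∑ k ∈ J, (if N.mu k < d k then rateCost (d k) (N.mu k) else 0) +
  ∑ k, ENNReal.ofReal (d k) *
    (∑ l, rateCost (R k l) (N.P k l) + rateCost (1 - ∑ l, R k l) (1 - ∑ l, N.P k l))

/-- The local rate function `L_J(y)`: the infimum of `ψ_J(a, d, R)` over `a, d ≥ 0` and
substochastic `R` with `y = a + (Rᵀ - I) d`. -/
def lagrangianOn (J : Finset (Fin K)) (y : Fin K → ℝ) : ℝ≥0∞ :=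
  ⨅ (a : Fin K → ℝ) (d : Fin K → ℝ) (R : Matrix (Fin K) (Fin K) ℝ)
    (_ : (∀ k, 0 ≤ a k) ∧ (∀ k, 0 ≤ d k) ∧ IsSubstochastic R ∧ y = a + (Rᵀ - 1) *ᵥ d),
    N.psi J a d R

/-- `L(x, y) = ∑_J 1_{F_J}(x) L_J(y)`. -/
def lagrangian (x y : Fin K → ℝ) : ℝ≥0∞ :=
  ∑ J : Finset (Fin K), (face J).indicator (fun _ => N.lagrangianOn J y) x

/-- The cost `∫_0^T L(q(t), q̇(t)) dt` of a path. -/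
def pathCost (T : ℝ) (q : ℝ → Fin K → ℝ) : ℝ≥0∞ :=
  ∫⁻ t in Set.Icc 0 T, N.lagrangian (q t) (deriv q t)

/-- The Hamiltonian of the face `F_J`: `H_J(θ) = sup_y (θ · y - L_J(y))`. -/
def hamiltonianOn (J : Finset (Fin K)) (θ : Fin K → ℝ) : EReal :=
  ⨆ y : Fin K → ℝ, ((θ ⬝ᵥ y : ℝ) : EReal) - (N.lagrangianOn J y : EReal)

/-- `h_k(θ) = e^{-θ_k} (∑_l (e^{θ_l} - 1) p_{kl} + 1) - 1`. -/
def h (k : Fin K) (θ : Fin K → ℝ) : ℝ :=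
  Real.exp (-θ k) * (∑ l, (Real.exp (θ l) - 1) * N.P k l + 1) - 1

/-- `H_0(θ) = ∑_k (e^{θ_k} - 1) λ_k + ∑_k h_k(θ) μ_k`. -/
def H0 (θ : Fin K → ℝ) : ℝ :=
  ∑ k, (Real.exp (θ k) - 1) * N.lam k + ∑ k, N.h k θ * N.mu k

/-- The conditions that define `θ^(m)`: `θ ≠ 0`, `h_k(θ) = 0` for `k ≠ m`, and `H_0(θ) = 0`. -/
def IsAxisMomentum (m : Fin K) (θ : Fin K → ℝ) : Prop :=
  θ ≠ 0 ∧ (∀ k, k ≠ m → N.h k θ = 0) ∧ N.H0 θ = 0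

/-- The conditions that define `θ̃^(J)`, where `θstar = (θ^(1)_1, …, θ^(K)_K)`:
`θ_k = θstar_k` for `k ∉ J`, and `h_k(θ) = 0` for `k ∈ J`. -/
def IsFaceMomentum (θstar : Fin K → ℝ) (J : Finset (Fin K)) (θ : Fin K → ℝ) : Prop :=
  (∀ k ∉ J, θ k = θstar k) ∧ ∀ k ∈ J, N.h k θ = 0

/-- There is a trajectory that runs through the face `F_J` with momentum `θ`, that is, stays in the
face for a time interval of positive length and satisfies `q̇(t) ∈ ∂H_J(θ)` a.e. there. The face
is called essential if this holds for `θ = θ̃^(J)`. -/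
def IsEssentialFace (J : Finset (Fin K)) (θ : Fin K → ℝ) : Prop :=
  ∃ (a b : ℝ) (q : ℝ → Fin K → ℝ), a < b ∧ AbsolutelyContinuousOnInterval q a b ∧
    (∀ t ∈ Set.Icc a b, q t ∈ face J) ∧
    ∀ᵐ t ∂(volume.restrict (Set.Icc a b)), IsSubgradient (N.hamiltonianOn J) θ (deriv q t)

end JacksonNetwork

end

noncomputable section

namespace JacksonNetwork

variable {K : ℕ} (N : JacksonNetwork K)

/-- The vector `(I - P) w`. -/
def resid (w : Fin K → ℝ) (k : Fin K) : ℝ := w k - ∑ l, N.P k l * w l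

lemma isUnit_det_one_sub_transpose : IsUnit (1 - N.Pᵀ).det := by
  have h1 : (1 : ℂ) ∉ spectrum ℂ (N.P.map (fun x : ℝ => (x : ℂ))) := by
    intro hmem
    have : (‖(1 : ℂ)‖₊ : ℝ≥0∞) ≤ spectralRadius ℂ (N.P.map (fun x : ℝ => (x : ℂ))) :=
      le_iSup₂ (f := fun (k : ℂ) (_ : k ∈ spectrum ℂ (N.P.map (fun x : ℝ => (x : ℂ)))) =>
        (‖k‖₊ : ℝ≥0∞)) 1 hmem
    have h2 := lt_of_le_of_lt this N.P_spectralRadius_lt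
    simp at h2
  rw [spectrum.notMem_iff, Matrix.isUnit_iff_isUnit_det, map_one] at h1
  have h2 : (1 - N.P.map (fun x : ℝ => (x : ℂ))) = (1 - N.P).map (Complex.ofRealHom) := by
    ext i j
    by_cases hij : i = j <;> simp [hij]
  have h3 : (1 - N.Pᵀ) = (1 - N.P)ᵀ := by simp
  rw [h3, Matrix.det_transpose, isUnit_iff_ne_zero]
  intro h0
  apply h1.ne_zero
  rw [h2, ← RingHom.mapMatrix_apply, ← RingHom.map_det, h0, map_zero]

lemma eq_nu_of_traffic {β : Fin K → ℝ} (hβ : ∀ k, β k = N.lam k + ∑ l, N.P l k * β l) :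
    β = N.nu := by
  have h1 : (1 - N.Pᵀ) *ᵥ β = N.lam := by
    ext k
    rw [Matrix.sub_mulVec, Matrix.one_mulVec, Pi.sub_apply]
    have := hβ k
    simp only [Matrix.mulVec, dotProduct, Matrix.transpose_apply]
    linarith
  rw [nu, ← h1, Matrix.mulVec_mulVec, Matrix.nonsing_inv_mul _ N.isUnit_det_one_sub_transpose,
    Matrix.one_mulVec]

lemma nu_traffic (k : Fin K) : N.nu k = N.lam k + ∑ l, N.P l k * N.nu l := by
  have h1 : (1 - N.Pᵀ) *ᵥ N.nu = N.lam := by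
    rw [nu, Matrix.mulVec_mulVec, Matrix.mul_nonsing_inv _ N.isUnit_det_one_sub_transpose,
      Matrix.one_mulVec]
  have := congrFun h1 k
  rw [Matrix.sub_mulVec, Matrix.one_mulVec, Pi.sub_apply] at this
  simp only [Matrix.mulVec, dotProduct, Matrix.transpose_apply] at this
  linarith

lemma sum_nu_mul_resid (w : Fin K → ℝ) :
    ∑ k, N.nu k * N.resid w k = ∑ k, N.lam k * w k := by
  have h1 : ∀ k, N.lam k * w k = N.nu k * w k - ∑ l, N.P l k * N.nu l * w k := by
    intro k
    have h : N.lam k = N.nu k - ∑ l, N.P l k * N.nu l := by linarith [N.nu_traffic k]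
    rw [h, sub_mul, Finset.sum_mul]
  simp only [h1, resid, mul_sub, Finset.sum_sub_distrib, Finset.mul_sum]
  congr 1
  rw [Finset.sum_comm]
  exact Finset.sum_congr rfl fun k _ => Finset.sum_congr rfl fun l _ => by ring

/-! ### Ergodicity forces the loads to be less than one -/

lemma generator_nonneg {f : (Fin K → ℕ) → ℝ} {x : Fin K → ℕ} (hf : ∀ y, f x ≤ f y) :
    0 ≤ N.generator f x := by
  unfold generator
  refine add_nonneg (Finset.sum_nonneg fun k _ =>
    mul_nonneg (N.lam_pos k).le (sub_nonneg.2 (hf _))) (Finset.sum_nonneg fun k _ => ?_)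
  split_ifs
  · exact mul_nonneg (N.mu_pos k).le (add_nonneg (Finset.sum_nonneg fun l _ =>
      mul_nonneg (N.P_nonneg k l) (sub_nonneg.2 (hf _)))
      (mul_nonneg (sub_nonneg.2 (N.P_row_sum_le k)) (sub_nonneg.2 (hf _))))
  · exact le_rfl

lemma abs_generator_le {f : (Fin K → ℕ) → ℝ} {x : Fin K → ℕ}
    (h1 : ∀ k, |f (x + Pi.single k 1) - f x| ≤ 1)
    (h2 : ∀ k l, 0 < x k → |f (x - Pi.single k 1 + Pi.single l 1) - f x| ≤ 1)
    (h3 : ∀ k, 0 < x k → |f (x - Pi.single k 1) - f x| ≤ 1) :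
    |N.generator f x| ≤ ∑ k, N.lam k + ∑ k, N.mu k := by
  unfold generator
  refine (abs_add_le _ _).trans (add_le_add ?_ ?_)
  · refine (Finset.abs_sum_le_sum_abs _ _).trans (Finset.sum_le_sum fun k _ => ?_)
    rw [abs_mul, abs_of_pos (N.lam_pos k)]
    exact mul_le_of_le_one_right (N.lam_pos k).le (h1 k)
  · refine (Finset.abs_sum_le_sum_abs _ _).trans (Finset.sum_le_sum fun k _ => ?_)
    split_ifs with hk
    · rw [abs_mul, abs_of_pos (N.mu_pos k)]
      refine mul_le_of_le_one_right (N.mu_pos k).le ?_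
      have h0 : 0 ≤ 1 - ∑ l, N.P k l := sub_nonneg.2 (N.P_row_sum_le k)
      calc _ ≤ ∑ l, N.P k l + (1 - ∑ l, N.P k l) := by
            refine (abs_add_le _ _).trans (add_le_add ?_ ?_)
            · refine (Finset.abs_sum_le_sum_abs _ _).trans (Finset.sum_le_sum fun l _ => ?_)
              rw [abs_mul, abs_of_nonneg (N.P_nonneg k l)]
              exact mul_le_of_le_one_right (N.P_nonneg k l) (h2 k l hk)
            · rw [abs_mul, abs_of_nonneg h0]
              exact mul_le_of_le_one_right h0 (h3 k hk)
        _ = 1 := by ring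
    · simpa using (N.mu_pos k).le

lemma generator_coord (k : Fin K) (x : Fin K → ℕ) :
    N.generator (fun y => (y k : ℝ)) x =
      N.lam k + ∑ l, if 0 < x l then N.mu l * (N.P l k - if l = k then 1 else 0) else 0 := by
  have e1 : ∀ l : Fin K, (((x + Pi.single l 1 : Fin K → ℕ) k : ℕ) : ℝ) - x k
      = if l = k then 1 else 0 := by
    intro l
    by_cases h : l = k
    · subst h; simp
    · simp [h]
  have e2 : ∀ l : Fin K, 0 < x l → (((x - Pi.single l 1 : Fin K → ℕ) k : ℕ) : ℝ) - x k
      = - if l = k then 1 else 0 := by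
    intro l hl
    by_cases h : l = k
    · subst h
      have : 1 ≤ x l := hl
      simp [Nat.cast_sub this]
    · simp [h]
  have e3 : ∀ l m : Fin K, 0 < x l →
      (((x - Pi.single l 1 + Pi.single m 1 : Fin K → ℕ) k : ℕ) : ℝ) - x k
      = (if m = k then 1 else 0) - if l = k then 1 else 0 := by
    intro l m hl
    have := e2 l hl
    by_cases h : m = k
    · subst h
      rw [Pi.add_apply, Nat.cast_add]
      simp only [Pi.single_eq_same, Nat.cast_one, if_true]
      linarith
    · rw [Pi.add_apply, Nat.cast_add]
      simp only [Pi.single_eq_of_ne (Ne.symm h), Nat.cast_zero, h, if_false]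
      linarith
  unfold generator
  congr 1
  · simp only [e1, mul_ite, mul_one, mul_zero]
    simp
  · refine Finset.sum_congr rfl fun l _ => ?_
    by_cases hl : 0 < x l
    · rw [if_pos hl, if_pos hl]
      congr 1
      dsimp only
      rw [e2 l hl, Finset.sum_congr rfl fun m _ => by rw [e3 l m hl]]
      simp only [mul_sub, Finset.sum_sub_distrib, mul_ite, mul_one, mul_zero,
        Finset.sum_ite_eq', Finset.mem_univ, if_true]
      split_ifs <;> simp
    · rw [if_neg hl, if_neg hl]

lemma tsum_generator_coord_of_stationary {p : (Fin K → ℕ) → ℝ} (hp0 : ∀ x, 0 ≤ p x) (hp1 : HasSum p 1)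
    (hst : ∀ f : (Fin K → ℕ) → ℝ, (∃ C : ℝ, ∀ x, |f x| ≤ C) →
      HasSum (fun x => p x * N.generator f x) 0) (k : Fin K) :
    ∑' x, p x * N.generator (fun y => (y k : ℝ)) x = 0 := by
  have hlip : ∀ (n a b : ℕ), a ≤ b + 1 → b ≤ a + 1 →
      |((min a n : ℕ) : ℝ) - ((min b n : ℕ) : ℝ)| ≤ 1 := by
    intro n a b h1 h2
    have h3 : min a n ≤ min b n + 1 := by omega
    have h4 : min b n ≤ min a n + 1 := by omega
    have h3' : ((min a n : ℕ) : ℝ) ≤ ((min b n : ℕ) : ℝ) + 1 := by exact_mod_cast h3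
    have h4' : ((min b n : ℕ) : ℝ) ≤ ((min a n : ℕ) : ℝ) + 1 := by exact_mod_cast h4
    rw [abs_le]; constructor <;> linarith
  have b1 : ∀ (x : Fin K → ℕ) (l : Fin K), (x + Pi.single l 1 : Fin K → ℕ) k ≤ x k + 1 ∧
      x k ≤ (x + Pi.single l 1 : Fin K → ℕ) k := by
    intro x l
    have : (Pi.single l 1 : Fin K → ℕ) k ≤ 1 := by
      by_cases h : k = l
      · subst h; simp
      · simp [Pi.single_eq_of_ne h]
    simp only [Pi.add_apply]; omega
  have b2 : ∀ (x : Fin K → ℕ) (l : Fin K), (x - Pi.single l 1 : Fin K → ℕ) k ≤ x k ∧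
      x k ≤ (x - Pi.single l 1 : Fin K → ℕ) k + 1 := by
    intro x l
    have : (Pi.single l 1 : Fin K → ℕ) k ≤ 1 := by
      by_cases h : k = l
      · subst h; simp
      · simp [Pi.single_eq_of_ne h]
    simp only [Pi.sub_apply]; omega
  have hlim : Filter.Tendsto
      (fun n : ℕ => ∑' x, p x * N.generator (fun y => ((min (y k) n : ℕ) : ℝ)) x)
      Filter.atTop (nhds (∑' x, p x * N.generator (fun y => (y k : ℝ)) x)) := by
    refine tendsto_tsum_of_dominated_convergence
      (bound := fun x => p x * (∑ k, N.lam k + ∑ k, N.mu k)) (hp1.summable.mul_right _) ?_ ?_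
    · intro x
      refine tendsto_const_nhds.congr' ?_
      filter_upwards [Filter.eventually_ge_atTop (x k + 2)] with n hn
      have key : ∀ y : Fin K → ℕ, y k ≤ x k + 2 → ((min (y k) n : ℕ) : ℝ) = (y k : ℝ) := by
        intro y hy
        rw [min_eq_left (by omega)]
      congr 1
      unfold generator
      dsimp only
      rw [key x (by omega)]
      congr 1
      · refine Finset.sum_congr rfl fun l _ => ?_
        rw [key _ (by have := b1 x l; omega)]
      · refine Finset.sum_congr rfl fun l _ => ?_
        split_ifs with hl
        · rw [key (x - Pi.single l 1) (by have := b2 x l; omega)]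
          congr 2
          refine Finset.sum_congr rfl fun m _ => ?_
          rw [key _ (by have := b2 x l; have := b1 (x - Pi.single l 1) m; omega)]
        · rfl
    · refine Filter.Eventually.of_forall fun n x => ?_
      rw [norm_mul, Real.norm_eq_abs, Real.norm_eq_abs, abs_of_nonneg (hp0 x)]
      refine mul_le_mul_of_nonneg_left (N.abs_generator_le ?_ ?_ ?_) (hp0 x)
      · intro l
        exact hlip n _ _ (by have := b1 x l; omega) (by have := b1 x l; omega)
      · intro l m _
        exact hlip n _ _
          (by have := b2 x l; have := b1 (x - Pi.single l 1) m; omega)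
          (by have := b2 x l; have := b1 (x - Pi.single l 1) m; omega)
      · intro l _
        exact hlip n _ _ (by have := b2 x l; omega) (by have := b2 x l; omega)
  have hz : ∀ n : ℕ, ∑' x, p x * N.generator (fun y => ((min (y k) n : ℕ) : ℝ)) x = 0 := by
    intro n
    refine (hst _ ⟨n, fun x => ?_⟩).tsum_eq
    rw [abs_of_nonneg (by positivity)]
    exact_mod_cast min_le_right _ _
  simp only [hz] at hlim
  exact tendsto_nhds_unique hlim tendsto_const_nhds

lemma eq_zero_of_stationary_of_boundary {p : (Fin K → ℕ) → ℝ} (hp0 : ∀ x, 0 ≤ p x)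
    (hst : ∀ f : (Fin K → ℕ) → ℝ, (∃ C : ℝ, ∀ x, |f x| ≤ C) →
      HasSum (fun x => p x * N.generator f x) 0) {k : Fin K} (hk : N.P k k < 1)
    (hb : ∀ x, x k = 0 → p x = 0) (x : Fin K → ℕ) : p x = 0 := by
  suffices H : ∀ n : ℕ, ∀ x : Fin K → ℕ, x k ≤ n → p x = 0 from H (x k) x le_rfl
  intro n
  induction n with
  | zero => exact fun x hx => hb x (by omega)
  | succ n ih =>
    intro x hx
    rcases Nat.lt_or_ge (x k) (n + 1) with hlt | hge
    · exact ih x (by omega)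
    have hxk : x k = n + 1 := by omega
    set f : (Fin K → ℕ) → ℝ := fun y => if y k ≤ n then 1 else 0 with hf
    have hf0 : ∀ y, 0 ≤ f y := fun y => by simp only [hf]; split_ifs <;> norm_num
    have hfs : ∀ y, n < y k → f y = 0 := fun y hy => by simp [hf, hy]
    have hs := hst f ⟨1, fun y => by simp only [hf]; split_ifs <;> simp⟩
    have hnn : ∀ y, 0 ≤ p y * N.generator f y := by
      intro y
      rcases Nat.lt_or_ge n (y k) with h | h
      · exact mul_nonneg (hp0 y) (N.generator_nonneg fun z => by rw [hfs y h]; exact hf0 z)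
      · rw [ih y h, zero_mul]
    have hx0 := congrFun ((hasSum_zero_iff_of_nonneg hnn).1 hs) x
    have hfx : f x = 0 := hfs x (by omega)
    have hgen : 0 < N.generator f x := by
      unfold generator
      rw [hfx]
      refine add_pos_of_nonneg_of_pos (Finset.sum_nonneg fun l _ =>
        mul_nonneg (N.lam_pos l).le (by simpa using hf0 _)) ?_
      refine lt_of_lt_of_le ?_ (Finset.single_le_sum (f := fun l => if 0 < x l then
        N.mu l * (∑ m, N.P l m * (f (x - Pi.single l 1 + Pi.single m 1) - 0) +
          (1 - ∑ m, N.P l m) * (f (x - Pi.single l 1) - 0)) else 0) ?_ (Finset.mem_univ k))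
      · have hd : f (x - Pi.single k 1) = 1 := by simp [hf, hxk]
        have hdm : ∀ m, m ≠ k → f (x - Pi.single k 1 + Pi.single m 1) = 1 := by
          intro m hm
          simp [hf, hxk, Pi.single_eq_of_ne (Ne.symm hm)]
        rw [if_pos (by omega), hd]
        refine mul_pos (N.mu_pos k) ?_
        have : ∑ m, N.P k m - N.P k k
            ≤ ∑ m, N.P k m * (f (x - Pi.single k 1 + Pi.single m 1) - 0) := by
          rw [← Finset.sum_erase_add _ _ (Finset.mem_univ k), add_sub_cancel_right,
            ← Finset.sum_erase_add _ _ (Finset.mem_univ k)]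
          refine le_add_of_le_of_nonneg (Finset.sum_le_sum fun m hm => ?_)
            (mul_nonneg (N.P_nonneg k k) (by simpa using hf0 _))
          rw [hdm m (Finset.ne_of_mem_erase hm)]
          simp
        linarith
      · intro l _
        split_ifs
        · refine mul_nonneg (N.mu_pos l).le (add_nonneg (Finset.sum_nonneg fun m _ =>
            mul_nonneg (N.P_nonneg l m) (by simpa using hf0 _))
            (mul_nonneg (sub_nonneg.2 (N.P_row_sum_le l)) (by simpa using hf0 _)))
        · exact le_rfl
    rcases mul_eq_zero.1 hx0 with h | h
    · exact h
    · exact absurd h hgen.ne'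

lemma IsErgodic.nu_pos_and_lt {N : JacksonNetwork K} (hN : N.IsErgodic) (k : Fin K) :
    0 < N.nu k ∧ N.nu k < N.mu k := by
  obtain ⟨p, hp0, hp1, hst⟩ := hN
  set c : Fin K → ℝ := fun l => ∑' x : Fin K → ℕ, if 0 < x l then p x else 0 with hc
  have hsum : ∀ l : Fin K, Summable fun x : Fin K → ℕ => if 0 < x l then p x else 0 := fun l =>
    Summable.of_nonneg_of_le (fun x => by split_ifs; exacts [hp0 x, le_rfl])
      (fun x => by split_ifs; exacts [le_rfl, hp0 x]) hp1.summable
  have hc0 : ∀ l, 0 ≤ c l := fun l => tsum_nonneg fun x => by split_ifs; exacts [hp0 x, le_rfl]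
  have hβ : ∀ k, N.mu k * c k = N.lam k + ∑ l, N.P l k * (N.mu l * c l) := by
    intro k
    have h1 := N.tsum_generator_coord_of_stationary hp0 hp1 hst k
    have h2 : HasSum (fun x => p x * N.generator (fun y => (y k : ℝ)) x)
        (1 * N.lam k + ∑ l, c l * (N.mu l * (N.P l k - if l = k then 1 else 0))) := by
      have h3 := (hp1.mul_right (N.lam k)).add (hasSum_sum (s := Finset.univ) fun l _ =>
        ((hsum l).hasSum.mul_right (N.mu l * (N.P l k - if l = k then 1 else 0))))
      refine h3.congr_fun fun x => ?_
      rw [generator_coord, mul_add, Finset.mul_sum]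
      congr 1
      refine Finset.sum_congr rfl fun l _ => ?_
      split_ifs <;> simp
    rw [h2.tsum_eq] at h1
    have h4 : ∑ l, c l * (N.mu l * (N.P l k - if l = k then 1 else 0))
        = ∑ l, N.P l k * (N.mu l * c l) - N.mu k * c k := by
      have : ∀ l, c l * (N.mu l * (N.P l k - if l = k then 1 else 0))
          = N.P l k * (N.mu l * c l) - if l = k then N.mu l * c l else 0 := by
        intro l; split_ifs <;> ring
      simp only [this, Finset.sum_sub_distrib, Finset.sum_ite_eq', Finset.mem_univ, if_true]
    linarith
  have hν := N.eq_nu_of_traffic (β := fun k => N.mu k * c k) hβ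
  have hνk : ∀ k, N.nu k = N.mu k * c k := fun k => (congrFun hν k).symm
  have hν0 : ∀ k, 0 ≤ N.nu k := fun k => by
    rw [hνk]; exact mul_nonneg (N.mu_pos k).le (hc0 k)
  have hνge : N.lam k + N.P k k * N.nu k ≤ N.nu k := by
    have := Finset.single_le_sum (f := fun l => N.P l k * N.nu l)
      (fun l _ => mul_nonneg (N.P_nonneg l k) (hν0 l)) (Finset.mem_univ k)
    have h := N.nu_traffic k
    linarith
  have hlam := N.lam_pos k
  have hνpos : 0 < N.nu k := by
    have := mul_nonneg (N.P_nonneg k k) (hν0 k)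
    linarith
  refine ⟨hνpos, ?_⟩
  by_contra hcon
  have hck : 1 ≤ c k := by
    rw [hνk] at hcon
    by_contra h
    exact hcon (mul_lt_of_lt_one_right (N.mu_pos k) (not_le.1 h))
  have hPkk : N.P k k < 1 := by
    by_contra h
    nlinarith [not_lt.1 h]
  have hd : HasSum (fun x : Fin K → ℕ => p x - if 0 < x k then p x else 0) (1 - c k) :=
    hp1.sub (hsum k).hasSum
  have hdn : ∀ x : Fin K → ℕ, 0 ≤ p x - if 0 < x k then p x else 0 := fun x => by
    split_ifs
    · simp
    · simpa using hp0 x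
  have h0 : 1 - c k = 0 := le_antisymm (by linarith) (hd.nonneg hdn)
  rw [h0] at hd
  have hb : ∀ x : Fin K → ℕ, x k = 0 → p x = 0 := fun x hx => by
    simpa [hx] using congrFun ((hasSum_zero_iff_of_nonneg hdn).1 hd) x
  have hall := N.eq_zero_of_stationary_of_boundary hp0 hst hPkk hb
  have : p = 0 := funext hall
  rw [this] at hp1
  exact zero_ne_one (hp1.unique hasSum_zero).symm

lemma resid_add (v w : Fin K → ℝ) (k : Fin K) : N.resid (v + w) k = N.resid v k + N.resid w k := by
  simp only [resid, Pi.add_apply, mul_add, Finset.sum_add_distrib]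
  ring

lemma resid_smul (c : ℝ) (w : Fin K → ℝ) (k : Fin K) : N.resid (c • w) k = c * N.resid w k := by
  simp only [resid, Pi.smul_apply, smul_eq_mul, mul_sub, Finset.mul_sum]
  congr 1
  exact Finset.sum_congr rfl fun l _ => by ring

lemma resid_sub (v w : Fin K → ℝ) (k : Fin K) : N.resid (v - w) k = N.resid v k - N.resid w k := by
  simp only [resid, Pi.sub_apply, mul_sub, Finset.sum_sub_distrib]
  ring

lemma resid_zero (k : Fin K) : N.resid 0 k = 0 := by simp [resid]

variable {N}

/-- The maximum principle for `I - P` on the set of nodes `J`. -/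
lemma nonneg_of_resid_nonneg (hν : ∀ k, 0 < N.nu k) {J : Finset (Fin K)} {g : Fin K → ℝ}
    (h1 : ∀ k ∉ J, 0 ≤ g k) (h2 : ∀ k ∈ J, 0 ≤ N.resid g k) (k : Fin K) : 0 ≤ g k := by
  set m : Fin K → ℝ := fun l => max (-g l) 0 with hm
  have hm0 : ∀ l, 0 ≤ m l := fun l => le_max_right _ _
  have hmg : ∀ l, -m l ≤ g l := fun l => by have := le_max_left (-g l) 0; simp only [hm]; linarith
  have hres : ∀ l, N.resid m l ≤ 0 := by
    intro l
    have hs : 0 ≤ ∑ j, N.P l j * m j :=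
      Finset.sum_nonneg fun j _ => mul_nonneg (N.P_nonneg l j) (hm0 j)
    rw [resid, sub_nonpos]
    refine max_le ?_ hs
    by_cases hl : l ∈ J
    · have h3 := h2 l hl
      have h4 : ∑ j, N.P l j * (-m j) ≤ ∑ j, N.P l j * g j :=
        Finset.sum_le_sum fun j _ => mul_le_mul_of_nonneg_left (hmg j) (N.P_nonneg l j)
      simp only [mul_neg, Finset.sum_neg_distrib] at h4
      rw [resid] at h3
      linarith
    · linarith [h1 l hl]
  have h5 : ∑ l, N.lam l * m l ≤ 0 := by
    rw [← N.sum_nu_mul_resid]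
    exact Finset.sum_nonpos fun l _ => mul_nonpos_of_nonneg_of_nonpos (hν l).le (hres l)
  have h6 : ∀ l ∈ Finset.univ, 0 ≤ N.lam l * m l := fun l _ => mul_nonneg (N.lam_pos l).le (hm0 l)
  have h7 := (Finset.sum_eq_zero_iff_of_nonneg h6).1 (le_antisymm h5 (Finset.sum_nonneg h6)) k
    (Finset.mem_univ k)
  have h8 : m k = 0 := (mul_eq_zero.1 h7).resolve_left (N.lam_pos k).ne'
  have := hmg k
  linarith

lemma eq_of_resid_eq (hν : ∀ k, 0 < N.nu k) {J : Finset (Fin K)} {g g' : Fin K → ℝ}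
    (h1 : ∀ k ∉ J, g k = g' k) (h2 : ∀ k ∈ J, N.resid g k = N.resid g' k) : g = g' := by
  funext k
  refine le_antisymm ?_ ?_
  · have := nonneg_of_resid_nonneg hν (J := J) (g := g' - g) (fun k hk => by simp [h1 k hk])
      (fun k hk => by simp [resid_sub, h2 k hk]) k
    simpa using this
  · have := nonneg_of_resid_nonneg hν (J := J) (g := g - g') (fun k hk => by simp [h1 k hk])
      (fun k hk => by simp [resid_sub, h2 k hk]) k
    simpa using this

lemma exists_resid_eq (hν : ∀ k, 0 < N.nu k) (J : Finset (Fin K)) (f : Fin K → ℝ) :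
    ∃ g : Fin K → ℝ, (∀ k ∉ J, g k = f k) ∧ ∀ k ∈ J, N.resid g k = f k := by
  let A : (Fin K → ℝ) →ₗ[ℝ] (Fin K → ℝ) :=
    { toFun := fun g k => if k ∈ J then N.resid g k else g k
      map_add' := fun v w => by funext k; by_cases hk : k ∈ J <;> simp [hk, resid_add]
      map_smul' := fun c w => by
        funext k
        by_cases hk : k ∈ J
        · simp only [hk, if_true, resid_smul, Pi.smul_apply, RingHom.id_apply, smul_eq_mul]
        · simp [hk] }
  have hA : ∀ g k, A g k = if k ∈ J then N.resid g k else g k := fun _ _ => rfl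
  have hinj : Function.Injective A := by
    intro g g' h
    refine eq_of_resid_eq hν (J := J) (fun k hk => ?_) (fun k hk => ?_)
    · simpa [hA, hk] using congrFun h k
    · simpa [hA, hk] using congrFun h k
  obtain ⟨g, hg⟩ := LinearMap.injective_iff_surjective.1 hinj f
  refine ⟨g, fun k hk => ?_, fun k hk => ?_⟩
  · simpa [hA, hk] using congrFun hg k
  · simpa [hA, hk] using congrFun hg k

variable (N)

/-- The conditions that characterize `w = exp θ - 1` for the momentum `θ` of the face `F_J`. -/
def IsFaceExcess (J : Finset (Fin K)) (w : Fin K → ℝ) : Prop :=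
  (∀ k ∉ J, w k = N.mu k / N.nu k - 1) ∧ ∀ k ∈ J, N.resid w k = 0

/-- The vector `exp θ - 1` for the momentum `θ` of the face `F_J`. -/
def faceExcess (J : Finset (Fin K)) : Fin K → ℝ := Classical.epsilon (N.IsFaceExcess J)

/-- The momentum of the face `F_J`. -/
def faceMomentum (J : Finset (Fin K)) (k : Fin K) : ℝ := Real.log (1 + N.faceExcess J k)

/-- The velocity of optimal paths in the face `F_J`. -/
def faceVelocity (J : Finset (Fin K)) (k : Fin K) : ℝ := N.nu k * N.resid (N.faceExcess J) k

/-- The condition `ρ_l ≤ exp (-θ_l)` for `l ∈ J`, where `θ` is the momentum of the face `F_J`. -/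
def IsAdmissible (J : Finset (Fin K)) : Prop :=
  ∀ l ∈ J, N.nu l * (1 + N.faceExcess J l) ≤ N.mu l

variable {N}

lemma isFaceExcess_faceExcess (hν : ∀ k, 0 < N.nu k) (J : Finset (Fin K)) :
    N.IsFaceExcess J (N.faceExcess J) := by
  obtain ⟨g, h1, h2⟩ := exists_resid_eq hν J fun k => if k ∈ J then 0 else N.mu k / N.nu k - 1
  refine Classical.epsilon_spec (p := N.IsFaceExcess J) ⟨g, fun k hk => ?_, fun k hk => ?_⟩
  · simpa [hk] using h1 k hk
  · simpa [hk] using h2 k hk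

lemma IsFaceExcess.eq (hν : ∀ k, 0 < N.nu k) {J : Finset (Fin K)} {w : Fin K → ℝ}
    (hw : N.IsFaceExcess J w) : w = N.faceExcess J := by
  obtain ⟨h1, h2⟩ := isFaceExcess_faceExcess hν J
  exact eq_of_resid_eq hν (fun k hk => by rw [hw.1 k hk, h1 k hk])
    (fun k hk => by rw [hw.2 k hk, h2 k hk])

lemma load_inv_sub_one_pos (hν : ∀ k, 0 < N.nu k) (hμ : ∀ k, N.nu k < N.mu k) (k : Fin K) :
    0 < N.mu k / N.nu k - 1 := by
  rw [sub_pos, one_lt_div (hν k)]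
  exact hμ k

lemma faceExcess_nonneg (hν : ∀ k, 0 < N.nu k) (hμ : ∀ k, N.nu k < N.mu k)
    (J : Finset (Fin K)) (k : Fin K) : 0 ≤ N.faceExcess J k := by
  obtain ⟨h1, h2⟩ := isFaceExcess_faceExcess hν J
  refine nonneg_of_resid_nonneg hν (J := J) (fun k hk => ?_) (fun k hk => (h2 k hk).ge) k
  rw [h1 k hk]
  exact (load_inv_sub_one_pos hν hμ k).le

lemma exp_faceMomentum (hν : ∀ k, 0 < N.nu k) (hμ : ∀ k, N.nu k < N.mu k)
    (J : Finset (Fin K)) (k : Fin K) :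
    Real.exp (N.faceMomentum J k) = 1 + N.faceExcess J k := by
  rw [faceMomentum, Real.exp_log]
  linarith [faceExcess_nonneg hν hμ J k]

lemma faceMomentum_of_notMem (hν : ∀ k, 0 < N.nu k) {J : Finset (Fin K)} {k : Fin K}
    (hk : k ∉ J) : N.faceMomentum J k = -Real.log (N.rho k) := by
  rw [faceMomentum, (isFaceExcess_faceExcess hν J).1 k hk, rho, ← Real.log_inv, inv_div]
  congr 1
  ring

lemma faceExcess_univ (hν : ∀ k, 0 < N.nu k) : N.faceExcess Finset.univ = 0 :=
  (IsFaceExcess.eq hν ⟨fun k hk => absurd (Finset.mem_univ k) hk, fun k _ => N.resid_zero k⟩).symm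

lemma faceVelocity_of_mem (hν : ∀ k, 0 < N.nu k) {J : Finset (Fin K)} {k : Fin K} (hk : k ∈ J) :
    N.faceVelocity J k = 0 := by
  rw [faceVelocity, (isFaceExcess_faceExcess hν J).2 k hk, mul_zero]

variable (N)

/-- `h_k` in terms of `exp θ - 1`. -/
lemma h_eq (k : Fin K) (θ : Fin K → ℝ) :
    N.h k θ = -N.resid (fun l => Real.exp (θ l) - 1) k / Real.exp (θ k) := by
  have h0 := Real.exp_pos (θ k)
  rw [h, resid, Real.exp_neg, eq_div_iff h0.ne']
  have : ∑ l, (Real.exp (θ l) - 1) * N.P k l = ∑ l, N.P k l * (Real.exp (θ l) - 1) :=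
    Finset.sum_congr rfl fun l _ => mul_comm _ _
  rw [this]
  field_simp
  ring

lemma h_eq_zero_iff (k : Fin K) (θ : Fin K → ℝ) :
    N.h k θ = 0 ↔ N.resid (fun l => Real.exp (θ l) - 1) k = 0 := by
  rw [h_eq, div_eq_zero_iff, neg_eq_zero, or_iff_left (Real.exp_pos _).ne']

lemma sum_exp_sub_one_mul_lam (θ : Fin K → ℝ) :
    ∑ k, (Real.exp (θ k) - 1) * N.lam k =
      ∑ k, N.nu k * N.resid (fun l => Real.exp (θ l) - 1) k := by
  rw [N.sum_nu_mul_resid]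
  exact Finset.sum_congr rfl fun k _ => mul_comm _ _

variable {N}

lemma isFaceMomentum_iff (hν : ∀ k, 0 < N.nu k) (hμ : ∀ k, N.nu k < N.mu k)
    (J : Finset (Fin K)) (θ : Fin K → ℝ) :
    N.IsFaceMomentum (fun k => -Real.log (N.rho k)) J θ ↔ θ = N.faceMomentum J := by
  constructor
  · rintro ⟨h1, h2⟩
    have : (fun l => Real.exp (θ l) - 1) = N.faceExcess J := by
      refine IsFaceExcess.eq hν ⟨fun k hk => ?_, fun k hk => (N.h_eq_zero_iff k θ).1 (h2 k hk)⟩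
      have hρ : 0 < N.rho k := div_pos (hν k) (N.mu_pos k)
      dsimp only
      rw [h1 k hk, Real.exp_neg, Real.exp_log hρ, rho, inv_div]
    funext k
    rw [faceMomentum, ← this]
    simp
  · rintro rfl
    refine ⟨fun k hk => faceMomentum_of_notMem hν hk, fun k hk => ?_⟩
    rw [h_eq_zero_iff]
    simp only [exp_faceMomentum hν hμ, add_sub_cancel_left]
    exact (isFaceExcess_faceExcess hν J).2 k hk

lemma isAxisMomentum_iff (hν : ∀ k, 0 < N.nu k) (hμ : ∀ k, N.nu k < N.mu k)
    (m : Fin K) (θ : Fin K → ℝ) :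
    N.IsAxisMomentum m θ ↔ θ = N.faceMomentum {m}ᶜ := by
  have hH : ∀ θ : Fin K → ℝ, (∀ k, k ≠ m → N.h k θ = 0) → N.H0 θ =
      N.resid (fun l => Real.exp (θ l) - 1) m * (N.nu m - N.mu m / Real.exp (θ m)) := by
    intro θ h1
    rw [H0, sum_exp_sub_one_mul_lam, Finset.sum_eq_single m, Finset.sum_eq_single m, h_eq]
    · ring
    · intro k _ hk; rw [h1 k hk, zero_mul]
    · simp
    · intro k _ hk; rw [(N.h_eq_zero_iff k θ).1 (h1 k hk), mul_zero]
    · simp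
  rw [← isFaceMomentum_iff hν hμ]
  have hρ : 0 < N.rho m := div_pos (hν m) (N.mu_pos m)
  constructor
  · rintro ⟨h0, h1, h2⟩
    refine ⟨fun k hk => ?_, fun k hk => h1 k (by simpa using hk)⟩
    obtain rfl : k = m := by simpa using hk
    rw [hH θ h1, mul_eq_zero] at h2
    rcases h2 with h2 | h2
    · refine absurd ?_ h0
      have : (fun l => Real.exp (θ l) - 1) = 0 :=
        eq_of_resid_eq hν (J := Finset.univ) (by simp) fun l _ => by
          rw [resid_zero]
          by_cases hl : l = k
          · rw [hl, h2]
          · exact (N.h_eq_zero_iff l θ).1 (h1 l hl)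
      funext l
      have h3 := congrFun this l
      simpa [sub_eq_zero] using h3
    · have h4 : Real.exp (θ k) = (N.rho k)⁻¹ := by
        rw [rho, inv_div, eq_div_iff (hν k).ne']
        have := Real.exp_pos (θ k)
        field_simp at h2
        linarith
      dsimp only
      rw [← Real.log_inv, ← h4, Real.log_exp]
  · rintro ⟨h1, h2⟩
    have h3 : ∀ k, k ≠ m → N.h k θ = 0 := fun k hk => h2 k (by simpa using hk)
    have h4 : θ m = -Real.log (N.rho m) := h1 m (by simp)
    refine ⟨fun h => ?_, h3, ?_⟩
    · have : 0 < -Real.log (N.rho m) :=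
        neg_pos.2 (Real.log_neg hρ ((div_lt_one (N.mu_pos m)).2 (hμ m)))
      rw [← h4, h] at this
      simp at this
    · rw [hH θ h3, h4, Real.exp_neg, Real.exp_log hρ, div_inv_eq_mul, rho,
        mul_div_cancel₀ _ (N.mu_pos m).ne', sub_self, mul_zero]

lemma rho_le_exp_iff_isAdmissible (hν : ∀ k, 0 < N.nu k) (hμ : ∀ k, N.nu k < N.mu k)
    (J : Finset (Fin K)) :
    (∀ l ∈ J, N.rho l ≤ Real.exp (-N.faceMomentum J l)) ↔ N.IsAdmissible J := by
  refine forall₂_congr fun l _ => ?_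
  have h0 : 0 < 1 + N.faceExcess J l := by linarith [faceExcess_nonneg hν hμ J l]
  rw [Real.exp_neg, exp_faceMomentum hν hμ, rho, div_le_iff₀ (N.mu_pos l), inv_mul_eq_div,
    le_div_iff₀ h0]

end JacksonNetwork

lemma ofReal_sum_le_sum_ofReal {ι : Type*} (s : Finset ι) (f : ι → ℝ) :
    ENNReal.ofReal (∑ i ∈ s, f i) ≤ ∑ i ∈ s, ENNReal.ofReal (f i) := by
  classical
  induction s using Finset.induction_on with
  | empty => simp
  | insert a s ha ih =>
    rw [Finset.sum_insert ha, Finset.sum_insert ha]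
    exact ENNReal.ofReal_add_le.trans (add_le_add le_rfl ih)

lemma ofReal_legendre_le_rateCost {x m : ℝ} (hx : 0 ≤ x) (hm : 0 ≤ m) (θ : ℝ) :
    ENNReal.ofReal (θ * x - (Real.exp θ - 1) * m) ≤ rateCost x m := by
  unfold rateCost
  split_ifs with h1 h2
  · simp [h1, h2]
  · exact le_top
  · refine ENNReal.ofReal_le_ofReal ?_
    have hm' : 0 < m := lt_of_le_of_ne hm (Ne.symm h1)
    obtain ⟨u, rfl⟩ : ∃ u, x = u * m := ⟨x / m, by field_simp⟩
    have hu : 0 ≤ u := nonneg_of_mul_nonneg_left hx hm'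
    rw [mul_div_cancel_right₀ _ h1, ← mul_assoc, ← sub_mul]
    refine mul_le_mul_of_nonneg_right ?_ hm
    unfold entropyFun
    have he := Real.exp_pos θ
    rcases hu.eq_or_lt with rfl | hu
    · simp
      linarith
    · have h3 := Real.log_le_sub_one_of_pos (div_pos he hu)
      rw [Real.log_div he.ne' hu.ne', Real.log_exp] at h3
      have h4 := mul_le_mul_of_nonneg_left h3 hu.le
      have h5 : u * (Real.exp θ / u - 1) = Real.exp θ - u := by field_simp
      nlinarith

lemma rateCost_mul_exp (m θ : ℝ) :
    rateCost (m * Real.exp θ) m =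
      ENNReal.ofReal (θ * (m * Real.exp θ) - (Real.exp θ - 1) * m) := by
  unfold rateCost
  split_ifs with h1 h2
  · simp [h1]
  · simp [h1] at h2
  · rw [mul_div_cancel_left₀ _ h1, entropyFun, Real.log_exp]
    congr 1
    ring

lemma legendre_mul_exp_nonneg {m : ℝ} (hm : 0 ≤ m) (θ : ℝ) :
    0 ≤ θ * (m * Real.exp θ) - (Real.exp θ - 1) * m := by
  have h1 := Real.add_one_le_exp (-θ)
  have h2 := mul_le_mul_of_nonneg_left h1 (Real.exp_pos θ).le
  rw [← Real.exp_add, add_neg_cancel, Real.exp_zero] at h2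
  have h3 : 0 ≤ θ * Real.exp θ - (Real.exp θ - 1) := by linarith
  nlinarith [mul_nonneg h3 hm]

namespace JacksonNetwork

variable {K : ℕ} (N : JacksonNetwork K)

/-- The closed form of the Hamiltonian of the face `F_J`. -/
def ham (J : Finset (Fin K)) (θ : Fin K → ℝ) : ℝ :=
  ∑ k, (Real.exp (θ k) - 1) * N.lam k + ∑ k ∈ Jᶜ, N.h k θ * N.mu k +
    ∑ k ∈ J, max (N.h k θ) 0 * N.mu k

/-- The logarithmic moment generating function of the displacement of a customer that leaves node
`k`. -/
def routingLog (θ : Fin K → ℝ) (k : Fin K) : ℝ :=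
  Real.log (∑ l, N.P k l * Real.exp (θ l) + (1 - ∑ l, N.P k l))

lemma routing_pos (θ : Fin K → ℝ) (k : Fin K) :
    0 < ∑ l, N.P k l * Real.exp (θ l) + (1 - ∑ l, N.P k l) := by
  have h0 : ∀ l ∈ Finset.univ, 0 ≤ N.P k l * Real.exp (θ l) := fun l _ =>
    mul_nonneg (N.P_nonneg k l) (Real.exp_pos _).le
  have h1 := Finset.sum_nonneg h0
  have h2 : 0 ≤ 1 - ∑ l, N.P k l := sub_nonneg.2 (N.P_row_sum_le k)
  refine lt_of_le_of_ne (add_nonneg h1 h2) fun h => ?_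
  have h3 : ∑ l, N.P k l * Real.exp (θ l) = 0 := by linarith
  have h4 : ∀ l, N.P k l = 0 := fun l =>
    (mul_eq_zero.1 ((Finset.sum_eq_zero_iff_of_nonneg h0).1 h3 l (Finset.mem_univ l))).resolve_right
      (Real.exp_pos _).ne'
  simp [h4] at h

lemma exp_routingLog (θ : Fin K → ℝ) (k : Fin K) :
    Real.exp (N.routingLog θ k) = ∑ l, N.P k l * Real.exp (θ l) + (1 - ∑ l, N.P k l) := by
  rw [routingLog, Real.exp_log (N.routing_pos θ k)]

lemma exp_routingLog_sub (θ : Fin K → ℝ) (k : Fin K) :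
    Real.exp (N.routingLog θ k - θ k) = 1 + N.h k θ := by
  rw [Real.exp_sub, exp_routingLog, h, Real.exp_neg]
  have : ∑ l, (Real.exp (θ l) - 1) * N.P k l = ∑ l, N.P k l * Real.exp (θ l) - ∑ l, N.P k l := by
    rw [← Finset.sum_sub_distrib]
    exact Finset.sum_congr rfl fun l _ => by ring
  rw [this]
  ring

lemma dotProduct_sub_ham (J : Finset (Fin K)) (θ a d : Fin K → ℝ)
    (R : Matrix (Fin K) (Fin K) ℝ) :
    θ ⬝ᵥ (a + (Rᵀ - 1) *ᵥ d) - N.ham J θ =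
      ∑ k, (θ k * a k - (Real.exp (θ k) - 1) * N.lam k) +
      ∑ k ∈ Jᶜ, ((N.routingLog θ k - θ k) * d k - N.h k θ * N.mu k) +
      ∑ k ∈ J, ((N.routingLog θ k - θ k) * d k - max (N.h k θ) 0 * N.mu k) +
      ∑ k, d k * (∑ l, θ l * R k l - N.routingLog θ k) := by
  have h1 : θ ⬝ᵥ (a + (Rᵀ - 1) *ᵥ d) =
      ∑ k, θ k * a k + ∑ k, d k * ∑ l, θ l * R k l - ∑ k, θ k * d k := by
    rw [Matrix.sub_mulVec, Matrix.one_mulVec, dotProduct_add, dotProduct_sub]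
    have : θ ⬝ᵥ (Rᵀ *ᵥ d) = ∑ k, d k * ∑ l, θ l * R k l := by
      simp only [dotProduct, Matrix.mulVec, Matrix.transpose_apply, Finset.mul_sum]
      rw [Finset.sum_comm]
      exact Finset.sum_congr rfl fun k _ => Finset.sum_congr rfl fun l _ => by ring
    rw [this]
    simp only [dotProduct]
    ring
  have h2 := Finset.sum_add_sum_compl J fun k => (N.routingLog θ k - θ k) * d k
  have h3 : ∑ k, (N.routingLog θ k - θ k) * d k =
      ∑ k, d k * N.routingLog θ k - ∑ k, θ k * d k := by
    rw [← Finset.sum_sub_distrib]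
    exact Finset.sum_congr rfl fun l _ => by ring
  rw [h1, ham]
  simp only [Finset.sum_sub_distrib, mul_sub]
  simp only [sub_mul, Finset.sum_sub_distrib] at h2 h3 ⊢
  linarith

/-- Weak duality for the cost `ψ_J`. -/
lemma ofReal_le_psi (J : Finset (Fin K)) (θ : Fin K → ℝ) {a d : Fin K → ℝ}
    {R : Matrix (Fin K) (Fin K) ℝ} (ha : ∀ k, 0 ≤ a k) (hd : ∀ k, 0 ≤ d k)
    (hR : IsSubstochastic R) :
    ENNReal.ofReal (θ ⬝ᵥ (a + (Rᵀ - 1) *ᵥ d) - N.ham J θ) ≤ N.psi J a d R := by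
  rw [dotProduct_sub_ham, psi]
  refine ENNReal.ofReal_add_le.trans (add_le_add (ENNReal.ofReal_add_le.trans (add_le_add
    (ENNReal.ofReal_add_le.trans (add_le_add ?_ ?_)) ?_)) ?_)
  · exact (ofReal_sum_le_sum_ofReal _ _).trans (Finset.sum_le_sum fun k _ =>
      ofReal_legendre_le_rateCost (ha k) (N.lam_pos k).le _)
  · refine (ofReal_sum_le_sum_ofReal _ _).trans (Finset.sum_le_sum fun k _ => ?_)
    have := ofReal_legendre_le_rateCost (hd k) (N.mu_pos k).le (N.routingLog θ k - θ k)
    rwa [exp_routingLog_sub, add_sub_cancel_left] at this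
  · refine (ofReal_sum_le_sum_ofReal _ _).trans (Finset.sum_le_sum fun k _ => ?_)
    have h1 := ofReal_legendre_le_rateCost (hd k) (N.mu_pos k).le (N.routingLog θ k - θ k)
    have h2 := N.exp_routingLog_sub θ k
    rw [h2, add_sub_cancel_left] at h1
    have hm := N.mu_pos k
    split_ifs with hdk
    · refine le_trans (ENNReal.ofReal_le_ofReal ?_) h1
      have := mul_le_mul_of_nonneg_right (le_max_left (N.h k θ) 0) hm.le
      linarith
    · rw [ENNReal.ofReal_eq_zero.2]
      rw [not_lt] at hdk
      rw [sub_nonpos]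
      have h3 := Real.add_one_le_exp (N.routingLog θ k - θ k)
      rw [h2] at h3
      have h4 : N.routingLog θ k - θ k ≤ max (N.h k θ) 0 := le_trans (by linarith)
        (le_max_left _ _)
      calc _ ≤ max (N.h k θ) 0 * d k := mul_le_mul_of_nonneg_right h4 (hd k)
        _ ≤ _ := mul_le_mul_of_nonneg_left hdk (le_max_right _ _)
  · refine (ofReal_sum_le_sum_ofReal _ _).trans (Finset.sum_le_sum fun k _ => ?_)
    rw [ENNReal.ofReal_mul (hd k)]
    refine mul_le_mul_right ?_ _
    set c := N.routingLog θ k with hc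
    have h1 : ∑ l, θ l * R k l - c =
        ∑ l, ((θ l - c) * R k l - (Real.exp (θ l - c) - 1) * N.P k l) +
          ((-c) * (1 - ∑ l, R k l) - (Real.exp (-c) - 1) * (1 - ∑ l, N.P k l)) := by
      have h2 : ∑ l, Real.exp (θ l - c) * N.P k l + Real.exp (-c) * (1 - ∑ l, N.P k l) = 1 := by
        have h3 := N.exp_routingLog θ k
        rw [← hc] at h3
        have h4 : ∀ l, Real.exp (θ l - c) * N.P k l
            = Real.exp (-c) * (N.P k l * Real.exp (θ l)) := by
          intro l
          rw [sub_eq_add_neg, Real.exp_add]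
          ring
        simp only [h4]
        rw [← Finset.mul_sum, ← mul_add, ← h3, ← Real.exp_add, neg_add_cancel, Real.exp_zero]
      simp only [sub_mul, Finset.sum_sub_distrib, one_mul, ← Finset.mul_sum]
      linarith
    rw [h1]
    refine ENNReal.ofReal_add_le.trans (add_le_add ((ofReal_sum_le_sum_ofReal _ _).trans
      (Finset.sum_le_sum fun l _ => ofReal_legendre_le_rateCost (hR.1 k l) (N.P_nonneg k l) _))
      (ofReal_legendre_le_rateCost (sub_nonneg.2 (hR.2 k)) (sub_nonneg.2 (N.P_row_sum_le k)) _))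

lemma ofReal_le_lagrangianOn (J : Finset (Fin K)) (θ y : Fin K → ℝ) :
    ENNReal.ofReal (θ ⬝ᵥ y - N.ham J θ) ≤ N.lagrangianOn J y := by
  unfold lagrangianOn
  refine le_iInf fun a => le_iInf fun d => le_iInf fun R => le_iInf fun ⟨ha, hd, hR, hy⟩ => ?_
  rw [hy]
  exact N.ofReal_le_psi J θ ha hd hR

/-- The routing matrix of the network twisted by the momentum `θ`. -/
def twistedP (θ : Fin K → ℝ) : Matrix (Fin K) (Fin K) ℝ :=
  Matrix.of fun k l => N.P k l * Real.exp (θ l - N.routingLog θ k)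

lemma one_sub_sum_twistedP (θ : Fin K → ℝ) (k : Fin K) :
    1 - ∑ l, N.twistedP θ k l = (1 - ∑ l, N.P k l) * Real.exp (-N.routingLog θ k) := by
  have h3 := N.exp_routingLog θ k
  have h4 : ∀ l, N.twistedP θ k l
      = Real.exp (-N.routingLog θ k) * (N.P k l * Real.exp (θ l)) := by
    intro l
    simp only [twistedP, Matrix.of_apply]
    rw [sub_eq_add_neg, Real.exp_add]
    ring
  have h5 : Real.exp (-N.routingLog θ k) * Real.exp (N.routingLog θ k) = 1 := by
    rw [← Real.exp_add, neg_add_cancel, Real.exp_zero]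
  simp only [h4]
  rw [← Finset.mul_sum]
  rw [h3, mul_add] at h5
  linarith

lemma isSubstochastic_twistedP (θ : Fin K → ℝ) : IsSubstochastic (N.twistedP θ) := by
  refine ⟨fun k l => mul_nonneg (N.P_nonneg k l) (Real.exp_pos _).le, fun k => ?_⟩
  rw [← sub_nonneg, one_sub_sum_twistedP]
  exact mul_nonneg (sub_nonneg.2 (N.P_row_sum_le k)) (Real.exp_pos _).le

/-- Equality in the weak duality for the rates that are twisted by the momentum `θ`. -/
lemma lagrangianOn_twisted (J : Finset (Fin K)) {θ d y : Fin K → ℝ} (hJ : ∀ k ∈ J, N.h k θ = 0)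
    (hd : ∀ k, 0 ≤ d k) (hd1 : ∀ k ∈ J, d k ≤ N.mu k) (hd2 : ∀ k ∉ J, d k = N.mu k * (1 + N.h k θ))
    (hy : ∀ k, y k = N.lam k * Real.exp (θ k) + ∑ l, N.twistedP θ l k * d l - d k) :
    0 ≤ θ ⬝ᵥ y - N.ham J θ ∧ N.lagrangianOn J y ≤ ENNReal.ofReal (θ ⬝ᵥ y - N.ham J θ) := by
  set a : Fin K → ℝ := fun k => N.lam k * Real.exp (θ k) with ha
  have hy' : y = a + ((N.twistedP θ)ᵀ - 1) *ᵥ d := by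
    funext k
    rw [hy k, Matrix.sub_mulVec, Matrix.one_mulVec]
    simp only [Pi.add_apply, Pi.sub_apply, Matrix.mulVec, dotProduct, Matrix.transpose_apply, ha]
    ring
  have t1 : ∀ k ∈ Finset.univ, 0 ≤ θ k * a k - (Real.exp (θ k) - 1) * N.lam k := fun k _ =>
    legendre_mul_exp_nonneg (N.lam_pos k).le _
  have e2 : ∀ k ∈ Jᶜ, (N.routingLog θ k - θ k) * d k - N.h k θ * N.mu k =
      (N.routingLog θ k - θ k) * (N.mu k * Real.exp (N.routingLog θ k - θ k)) -
        (Real.exp (N.routingLog θ k - θ k) - 1) * N.mu k := fun k hk => by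
    rw [exp_routingLog_sub, hd2 k (by simpa using hk), add_sub_cancel_left]
  have t2 : ∀ k ∈ Jᶜ, 0 ≤ (N.routingLog θ k - θ k) * d k - N.h k θ * N.mu k := fun k hk => by
    rw [e2 k hk]
    exact legendre_mul_exp_nonneg (N.mu_pos k).le _
  have t3 : ∑ k ∈ J, ((N.routingLog θ k - θ k) * d k - max (N.h k θ) 0 * N.mu k) = 0 := by
    refine Finset.sum_eq_zero fun k hk => ?_
    have h1 := N.exp_routingLog_sub θ k
    rw [hJ k hk, add_zero, Real.exp_eq_one_iff] at h1
    rw [h1, hJ k hk]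
    simp
  have e4 : ∀ k, ∑ l, θ l * N.twistedP θ k l - N.routingLog θ k =
      ∑ l, ((θ l - N.routingLog θ k) * (N.P k l * Real.exp (θ l - N.routingLog θ k)) -
        (Real.exp (θ l - N.routingLog θ k) - 1) * N.P k l) +
      ((-N.routingLog θ k) * ((1 - ∑ l, N.P k l) * Real.exp (-N.routingLog θ k)) -
        (Real.exp (-N.routingLog θ k) - 1) * (1 - ∑ l, N.P k l)) := by
    intro k
    have h1 := N.one_sub_sum_twistedP θ k
    have h2 : ∀ l, (θ l - N.routingLog θ k) * (N.P k l * Real.exp (θ l - N.routingLog θ k)) -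
        (Real.exp (θ l - N.routingLog θ k) - 1) * N.P k l =
        θ l * N.twistedP θ k l - N.routingLog θ k * N.twistedP θ k l - N.twistedP θ k l
          + N.P k l := by
      intro l
      simp only [twistedP, Matrix.of_apply]
      ring
    simp only [h2, Finset.sum_add_distrib, Finset.sum_sub_distrib, ← Finset.mul_sum]
    rw [← h1, sub_mul, mul_comm (Real.exp _), ← h1]
    ring
  have t4 : ∀ k ∈ Finset.univ, 0 ≤ d k * (∑ l, θ l * N.twistedP θ k l - N.routingLog θ k) := by
    intro k _
    rw [e4]
    exact mul_nonneg (hd k) (add_nonneg (Finset.sum_nonneg fun l _ =>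
      legendre_mul_exp_nonneg (N.P_nonneg k l) _)
      (legendre_mul_exp_nonneg (sub_nonneg.2 (N.P_row_sum_le k)) _))
  have hid := N.dotProduct_sub_ham J θ a d (N.twistedP θ)
  rw [← hy', t3, add_zero] at hid
  have s1 := Finset.sum_nonneg t1
  have s2 := Finset.sum_nonneg t2
  have s4 := Finset.sum_nonneg t4
  refine ⟨by rw [hid]; positivity, ?_⟩
  refine (iInf_le_of_le a <| iInf_le_of_le d <| iInf_le_of_le (N.twistedP θ) <|
    iInf_le_of_le ⟨fun k => mul_nonneg (N.lam_pos k).le (Real.exp_pos _).le, hd,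
      N.isSubstochastic_twistedP θ, hy'⟩ (le_of_eq ?_))
  rw [hid, ENNReal.ofReal_add (add_nonneg s1 s2) s4, ENNReal.ofReal_add s1 s2,
    ENNReal.ofReal_sum_of_nonneg t1, ENNReal.ofReal_sum_of_nonneg t2,
    ENNReal.ofReal_sum_of_nonneg t4, psi]
  have p3 : ∑ k ∈ J, (if N.mu k < d k then rateCost (d k) (N.mu k) else 0) = 0 :=
    Finset.sum_eq_zero fun k hk => if_neg (not_lt.2 (hd1 k hk))
  rw [p3, add_zero]
  congr 1
  · congr 1
    · exact Finset.sum_congr rfl fun k _ => rateCost_mul_exp _ _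
    · refine Finset.sum_congr rfl fun k hk => ?_
      rw [e2 k hk, ← rateCost_mul_exp, exp_routingLog_sub,
        hd2 k (by simpa using hk)]
  · refine Finset.sum_congr rfl fun k _ => ?_
    rw [ENNReal.ofReal_mul (hd k), e4, one_sub_sum_twistedP,
      rateCost_mul_exp,
      ENNReal.ofReal_add (Finset.sum_nonneg fun l _ =>
        legendre_mul_exp_nonneg (N.P_nonneg k l) _)
        (legendre_mul_exp_nonneg (sub_nonneg.2 (N.P_row_sum_le k)) _),
      ENNReal.ofReal_sum_of_nonneg fun l _ => legendre_mul_exp_nonneg (N.P_nonneg k l) _]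
    congr 2
    exact Finset.sum_congr rfl fun l _ => rateCost_mul_exp _ _

lemma le_hamiltonianOn {J : Finset (Fin K)} {y : Fin K → ℝ} {c : ℝ} (hc : 0 ≤ c)
    (hy : N.lagrangianOn J y ≤ ENNReal.ofReal c) (θ : Fin K → ℝ) :
    ((θ ⬝ᵥ y - c : ℝ) : EReal) ≤ N.hamiltonianOn J θ := by
  refine le_trans ?_ (le_iSup _ y)
  rw [EReal.coe_sub]
  refine EReal.sub_le_sub le_rfl ?_
  have := EReal.coe_ennreal_le_coe_ennreal_iff.2 hy
  rwa [EReal.coe_ennreal_ofReal, max_eq_left hc] at this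

lemma hamiltonianOn_le (J : Finset (Fin K)) (θ : Fin K → ℝ) :
    N.hamiltonianOn J θ ≤ (N.ham J θ : EReal) := by
  refine iSup_le fun y => ?_
  have h1 := N.ofReal_le_lagrangianOn J θ y
  generalize N.lagrangianOn J y = L at h1
  induction L using ENNReal.recTopCoe with
  | top => simp
  | coe l =>
    have h2 : θ ⬝ᵥ y - N.ham J θ ≤ l := by
      have := ENNReal.toReal_mono ENNReal.coe_ne_top h1
      rw [ENNReal.toReal_ofReal'] at this
      exact (le_max_left _ _).trans this
    have h3 : (((l : ℝ≥0∞)) : EReal) = ((l : ℝ) : EReal) := rfl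
    rw [h3, ← EReal.coe_sub]
    exact EReal.coe_le_coe_iff.2 (by linarith)

variable {N}

lemma h_faceMomentum_of_mem (hν : ∀ k, 0 < N.nu k) (hμ : ∀ k, N.nu k < N.mu k)
    {J : Finset (Fin K)} {k : Fin K} (hk : k ∈ J) : N.h k (N.faceMomentum J) = 0 :=
  ((isFaceMomentum_iff hν hμ J _).2 rfl).2 k hk

lemma ham_faceMomentum (hν : ∀ k, 0 < N.nu k) (hμ : ∀ k, N.nu k < N.mu k) (J : Finset (Fin K)) :
    N.ham J (N.faceMomentum J) = 0 := by
  obtain ⟨f1, f2⟩ := isFaceExcess_faceExcess hν J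
  have h1 : ∑ k ∈ J, max (N.h k (N.faceMomentum J)) 0 * N.mu k = 0 :=
    Finset.sum_eq_zero fun k hk => by rw [h_faceMomentum_of_mem hν hμ hk]; simp
  rw [ham, h1, add_zero, sum_exp_sub_one_mul_lam, ← Finset.sum_add_sum_compl J]
  simp only [h_eq, exp_faceMomentum hν hμ, add_sub_cancel_left]
  rw [Finset.sum_eq_zero (s := J) fun k hk => by rw [f2 k hk, mul_zero], zero_add,
    ← Finset.sum_add_distrib]
  refine Finset.sum_eq_zero fun k hk => ?_
  have h3 := hν k
  have h4 := N.mu_pos k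
  rw [f1 k (by simpa using hk), add_sub_cancel]
  field_simp
  ring

lemma hamiltonianOn_faceMomentum (hν : ∀ k, 0 < N.nu k) (hμ : ∀ k, N.nu k < N.mu k)
    (J : Finset (Fin K)) : N.hamiltonianOn J (N.faceMomentum J) = 0 := by
  refine le_antisymm ?_ ?_
  · simpa [ham_faceMomentum hν hμ J] using N.hamiltonianOn_le J (N.faceMomentum J)
  · set θ := N.faceMomentum J
    obtain ⟨h1, h2⟩ := N.lagrangianOn_twisted J (θ := θ)
      (d := fun k => if k ∈ J then 0 else N.mu k * (1 + N.h k θ))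
      (fun k hk => h_faceMomentum_of_mem hν hμ hk)
      (fun k => by
        split_ifs
        · exact le_rfl
        · rw [← exp_routingLog_sub]
          exact mul_nonneg (N.mu_pos k).le (Real.exp_pos _).le)
      (fun k hk => by simpa [hk] using (N.mu_pos k).le)
      (fun k hk => by simp [hk]) (fun k => rfl)
    have h3 := N.le_hamiltonianOn h1 h2 θ
    rwa [ham_faceMomentum hν hμ, sub_zero, sub_self, EReal.coe_zero] at h3

/-- The cost of running through an admissible face with the velocity of the optimal path. -/
lemma lagrangianOn_faceVelocity (hν : ∀ k, 0 < N.nu k) (hμ : ∀ k, N.nu k < N.mu k)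
    {J : Finset (Fin K)} (hJ : N.IsAdmissible J) :
    0 ≤ N.faceMomentum J ⬝ᵥ N.faceVelocity J ∧ N.lagrangianOn J (N.faceVelocity J) =
      ENNReal.ofReal (N.faceMomentum J ⬝ᵥ N.faceVelocity J) := by
  obtain ⟨f1, f2⟩ := isFaceExcess_faceExcess hν J
  set θ := N.faceMomentum J with hθ
  have hexp : ∀ k, Real.exp (N.routingLog θ k) =
      1 + N.faceExcess J k - N.resid (N.faceExcess J) k := by
    intro k
    simp only [exp_routingLog, hθ, exp_faceMomentum hν hμ, resid, mul_add, mul_one,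
      Finset.sum_add_distrib]
    ring
  have hh : ∀ k, 1 + N.h k θ =
      (1 + N.faceExcess J k - N.resid (N.faceExcess J) k) / (1 + N.faceExcess J k) := by
    intro k
    rw [← exp_routingLog_sub, Real.exp_sub, hexp, hθ, exp_faceMomentum hν hμ]
  have key := N.lagrangianOn_twisted J (θ := θ) (y := N.faceVelocity J)
      (d := fun k => N.nu k * Real.exp (N.routingLog θ k))
      (fun k hk => h_faceMomentum_of_mem hν hμ hk)
      (fun k => mul_nonneg (hν k).le (Real.exp_pos _).le)
      (fun k hk => by
        rw [hexp, f2 k hk, sub_zero]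
        exact hJ k hk)
      (fun k hk => by
        rw [hexp, hh, f1 k hk]
        have := hν k
        have := N.mu_pos k
        rw [add_sub_cancel]
        field_simp)
      (fun k => by
        have h1 : ∀ l, N.twistedP θ l k * (N.nu l * Real.exp (N.routingLog θ l)) =
            N.P l k * N.nu l * Real.exp (θ k) := by
          intro l
          simp only [twistedP, Matrix.of_apply]
          rw [Real.exp_sub]
          have := Real.exp_pos (N.routingLog θ l)
          field_simp
        simp only [h1]
        rw [← Finset.sum_mul, ← add_mul, ← N.nu_traffic, hexp, hθ, exp_faceMomentum hν hμ,
          faceVelocity]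
        ring)
  rw [ham_faceMomentum hν hμ, sub_zero] at key
  refine ⟨key.1, le_antisymm key.2 ?_⟩
  have := N.ofReal_le_lagrangianOn J θ (N.faceVelocity J)
  rwa [ham_faceMomentum hν hμ, sub_zero] at this

lemma isSubgradient_faceVelocity (hν : ∀ k, 0 < N.nu k) (hμ : ∀ k, N.nu k < N.mu k)
    {J : Finset (Fin K)} (hJ : N.IsAdmissible J) :
    IsSubgradient (N.hamiltonianOn J) (N.faceMomentum J) (N.faceVelocity J) := by
  intro θ'
  obtain ⟨h1, h2⟩ := lagrangianOn_faceVelocity hν hμ hJ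
  have h3 := N.le_hamiltonianOn h1 h2.le θ'
  rw [hamiltonianOn_faceMomentum hν hμ, zero_add, dotProduct_sub, dotProduct_comm,
    dotProduct_comm _ (N.faceMomentum J)]
  exact h3

lemma ham_eq_of_exp_eq (J : Finset (Fin K)) {θ w : Fin K → ℝ}
    (hw : ∀ k, Real.exp (θ k) = 1 + w k) :
    N.ham J θ = ∑ k ∈ Jᶜ, (N.nu k - N.mu k / (1 + w k)) * N.resid w k +
      ∑ k ∈ J, (N.nu k * N.resid w k + max (-N.resid w k / (1 + w k)) 0 * N.mu k) := by
  have h1 : (fun l => Real.exp (θ l) - 1) = w := by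
    funext l
    rw [hw]
    ring
  rw [ham, sum_exp_sub_one_mul_lam, h1, ← Finset.sum_add_sum_compl J, Finset.sum_add_distrib]
  simp only [h_eq, h1]
  simp only [hw]
  have h2 : ∀ k, (N.nu k - N.mu k / (1 + w k)) * N.resid w k =
      N.nu k * N.resid w k + -N.resid w k / (1 + w k) * N.mu k := fun k => by ring
  simp only [h2, Finset.sum_add_distrib]
  ring

lemma eventually_perturbed_pos (hν : ∀ k, 0 < N.nu k) (hμ : ∀ k, N.nu k < N.mu k)
    (J : Finset (Fin K)) (g : Fin K → ℝ) :
    ∀ᶠ c in nhds (0 : ℝ), ∀ k, 0 < 1 + (N.faceExcess J + c • g) k := by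
  rw [Filter.eventually_all]
  intro k
  have hc : Continuous fun c : ℝ => 1 + (N.faceExcess J + c • g) k := by
    simp only [Pi.add_apply, Pi.smul_apply, smul_eq_mul]
    fun_prop
  refine hc.continuousAt.eventually (lt_mem_nhds ?_)
  have := faceExcess_nonneg hν hμ J k
  simp
  linarith

/-- A subgradient at the momentum of the face `F_J` that is tangent to the face is the velocity of
the optimal paths in the face, and the face is admissible. -/
lemma eq_faceVelocity_of_le_ham (hν : ∀ k, 0 < N.nu k) (hμ : ∀ k, N.nu k < N.mu k)
    {J : Finset (Fin K)} {v : Fin K → ℝ} (hv : ∀ k ∈ J, v k = 0)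
    (hsub : ∀ θ, v ⬝ᵥ (θ - N.faceMomentum J) ≤ N.ham J θ) :
    v = N.faceVelocity J ∧ N.IsAdmissible J := by
  obtain ⟨f1, f2⟩ := isFaceExcess_faceExcess hν J
  have hbal : ∀ k ∉ J, N.nu k - N.mu k / (1 + N.faceExcess J k) = 0 := by
    intro k hk
    have := hν k
    have := N.mu_pos k
    rw [f1 k hk, add_sub_cancel]
    field_simp
    ring
  have hlog : ∀ {w : Fin K → ℝ} (_ : ∀ k, 0 < 1 + w k) (k : Fin K),
      Real.exp ((fun k => Real.log (1 + w k)) k) = 1 + w k := fun hw k => Real.exp_log (hw k)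
  constructor
  · funext l
    by_cases hl : l ∈ J
    · rw [hv l hl, faceVelocity_of_mem hν hl]
    obtain ⟨g, g1, g2⟩ := exists_resid_eq hν J (Pi.single l 1)
    have gl : g l = 1 := by rw [g1 l hl, Pi.single_eq_same]
    have g0 : ∀ k ∉ J, k ≠ l → g k = 0 := fun k hk hkl => by
      rw [g1 k hk, Pi.single_eq_of_ne hkl]
    have gJ : ∀ k ∈ J, N.resid g k = 0 := fun k hk => by
      rw [g2 k hk, Pi.single_eq_of_ne (ne_of_mem_of_not_mem hk hl)]
    set z : ℝ := 1 + N.faceExcess J l with hz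
    have hz0 : 0 < z := by linarith [faceExcess_nonneg hν hμ J l]
    set A := N.resid (N.faceExcess J) l with hA
    set F : ℝ → ℝ := fun c => (N.nu l - N.mu l / (z + c)) * (A + c * N.resid g l) -
      v l * (Real.log (z + c) - Real.log z) with hF
    have hmin : IsLocalMin F 0 := by
      have hF0 : F 0 = 0 := by
        simp only [hF, add_zero, sub_self, mul_zero, hz, hbal l hl, zero_mul]
      filter_upwards [eventually_perturbed_pos hν hμ J g] with c hc
      rw [hF0]
      have h1 := hsub fun k => Real.log (1 + (N.faceExcess J + c • g) k)
      rw [ham_eq_of_exp_eq J (hlog hc)] at h1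
      have hr : ∀ k, N.resid (N.faceExcess J + c • g) k =
          N.resid (N.faceExcess J) k + c * N.resid g k := fun k => by
        rw [resid_add, resid_smul]
      rw [Finset.sum_eq_zero (s := J) fun k hk => by
        rw [hr, f2 k hk, gJ k hk]; simp, add_zero,
        Finset.sum_eq_single_of_mem l (by simpa using hl), dotProduct,
        Finset.sum_eq_single_of_mem l (Finset.mem_univ l), hr] at h1
      · simp only [Pi.sub_apply, Pi.add_apply, Pi.smul_apply, gl, smul_eq_mul, mul_one,
          faceMomentum, ← add_assoc] at h1
        simp only [hF]
        linarith
      · intro k _ hkl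
        by_cases hk : k ∈ J
        · rw [hv k hk, zero_mul]
        · simp [g0 k hk hkl, faceMomentum]
      · intro k hk hkl
        rw [Finset.mem_compl] at hk
        simp only [Pi.add_apply, Pi.smul_apply, g0 k hk hkl, smul_zero, add_zero, hbal k hk,
          zero_mul]
    have hzc : HasDerivAt (fun c : ℝ => z + c) 1 0 := (hasDerivAt_id 0).const_add z
    have hz00 : z + 0 ≠ 0 := by simpa using hz0.ne'
    have hd : HasDerivAt F ((-((0 * (z + 0) - N.mu l * 1) / (z + 0) ^ 2)) * (A + 0 * N.resid g l) +
        (N.nu l - N.mu l / (z + 0)) * (1 * N.resid g l) - v l * (1 / (z + 0))) 0 := by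
      refine HasDerivAt.sub (HasDerivAt.mul ?_ ?_) (HasDerivAt.const_mul _ ?_)
      · exact (((hasDerivAt_const (0 : ℝ) (N.mu l)).div hzc hz00).const_sub (N.nu l))
      · exact ((hasDerivAt_id (0 : ℝ)).mul_const (N.resid g l)).const_add A
      · exact (hzc.log hz00).sub_const _
    have h0 := hmin.hasDerivAt_eq_zero hd
    have hb := hbal l hl
    rw [← hz] at hb
    have hνz : N.nu l * z = N.mu l := by
      field_simp at hb
      linarith
    simp only [add_zero, hb, zero_mul, mul_one, zero_sub, neg_div, neg_neg] at h0
    rw [← hνz] at h0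
    have h1 : N.nu l * z / z ^ 2 * A - v l * (1 / z) = (N.nu l * A - v l) / z := by
      field_simp
    rw [h1, div_eq_zero_iff, or_iff_left hz0.ne'] at h0
    rw [faceVelocity, ← hA]
    linarith
  · intro j hj
    obtain ⟨g, g1, g2⟩ := exists_resid_eq hν J (Pi.single j 1)
    have g0 : ∀ k ∉ J, g k = 0 := fun k hk => by
      rw [g1 k hk, Pi.single_eq_of_ne (ne_of_mem_of_not_mem hj hk).symm]
    have gj : N.resid g j = 1 := by rw [g2 j hj, Pi.single_eq_same]
    have gJ : ∀ k ∈ J, k ≠ j → N.resid g k = 0 := fun k hk hkj => by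
      rw [g2 k hk, Pi.single_eq_of_ne hkj]
    have hev : ∀ᶠ c in nhdsWithin (0 : ℝ) (Set.Iio 0),
        N.nu j * (1 + (N.faceExcess J + c • g) j) ≤ N.mu j := by
      filter_upwards [(eventually_perturbed_pos hν hμ J g).filter_mono nhdsWithin_le_nhds,
        self_mem_nhdsWithin] with c hc hc0
      have hc0 : c < 0 := hc0
      have h1 := hsub fun k => Real.log (1 + (N.faceExcess J + c • g) k)
      rw [ham_eq_of_exp_eq J (hlog hc)] at h1
      have hr : ∀ k, N.resid (N.faceExcess J + c • g) k =
          N.resid (N.faceExcess J) k + c * N.resid g k := fun k => by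
        rw [resid_add, resid_smul]
      have hk0 : ∀ k ∉ J, (N.faceExcess J + c • g) k = N.faceExcess J k := fun k hk => by
        simp [g0 k hk]
      rw [Finset.sum_eq_zero (s := Jᶜ) fun k hk => by
        rw [Finset.mem_compl] at hk
        rw [hk0 k hk, hbal k hk, zero_mul], zero_add,
        Finset.sum_eq_single_of_mem j hj, dotProduct, Finset.sum_eq_zero, hr, f2 j hj, gj] at h1
      · have hp := hc j
        rw [zero_add, mul_one, max_eq_left (div_nonneg (by linarith) hp.le), neg_div, neg_mul,
          div_mul_eq_mul_div, ← sub_eq_add_neg, sub_nonneg, div_le_iff₀ hp] at h1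
        nlinarith
      · intro k _
        by_cases hk : k ∈ J
        · rw [hv k hk, zero_mul]
        · simp only [Pi.sub_apply, hk0 k hk, faceMomentum, sub_self, mul_zero]
      · intro k hk hkj
        rw [hr, f2 k hk, gJ k hk hkj]
        simp
    have hcont : Continuous fun c : ℝ => N.nu j * (1 + (N.faceExcess J + c • g) j) := by
      simp only [Pi.add_apply, Pi.smul_apply, smul_eq_mul]
      fun_prop
    have hlim := (hcont.tendsto 0).mono_left (nhdsWithin_le_nhds (s := Set.Iio 0))
    have := le_of_tendsto hlim hev
    simpa using this

lemma eq_faceVelocity_of_isSubgradient (hν : ∀ k, 0 < N.nu k) (hμ : ∀ k, N.nu k < N.mu k)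
    {J : Finset (Fin K)} {v : Fin K → ℝ} (hv : ∀ k ∈ J, v k = 0)
    (hsub : IsSubgradient (N.hamiltonianOn J) (N.faceMomentum J) v) :
    v = N.faceVelocity J ∧ N.IsAdmissible J := by
  refine eq_faceVelocity_of_le_ham hν hμ hv fun θ => ?_
  have h1 := (hsub θ).trans (N.hamiltonianOn_le J θ)
  rw [hamiltonianOn_faceMomentum hν hμ, zero_add] at h1
  exact EReal.coe_le_coe_iff.1 h1

lemma isEssentialFace_iff (hν : ∀ k, 0 < N.nu k) (hμ : ∀ k, N.nu k < N.mu k)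
    (J : Finset (Fin K)) : N.IsEssentialFace J (N.faceMomentum J) ↔ N.IsAdmissible J := by
  constructor
  · rintro ⟨a, b, q, hab, -, hq, hsub⟩
    have hIoo : ∀ᵐ t ∂(volume.restrict (Set.Ioo a b)),
        IsSubgradient (N.hamiltonianOn J) (N.faceMomentum J) (deriv q t) :=
      ae_mono (Measure.restrict_mono Set.Ioo_subset_Icc_self le_rfl) hsub
    have hne : (ae (volume.restrict (Set.Ioo a b))).NeBot := by
      rw [ae_neBot, Ne, Measure.restrict_eq_zero, Real.volume_Ioo, ENNReal.ofReal_eq_zero]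
      linarith
    obtain ⟨t, ht, ht1⟩ := (hIoo.and (ae_restrict_mem measurableSet_Ioo)).exists
    refine (eq_faceVelocity_of_isSubgradient hν hμ (fun k hk => ?_) ht).2
    by_cases hd : DifferentiableAt ℝ q t
    · have h1 := (hasDerivAt_pi.1 hd.hasDerivAt) k
      have h2 : (fun s => q s k) =ᶠ[nhds t] fun _ => 0 := by
        filter_upwards [Ioo_mem_nhds ht1.1 ht1.2] with s hs
        exact (hq s (Set.Ioo_subset_Icc_self hs)).1 k hk
      exact h1.unique ((hasDerivAt_const t (0 : ℝ)).congr_of_eventuallyEq h2)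
    · rw [deriv_zero_of_not_differentiableAt hd, Pi.zero_apply]
  · intro hJ
    set x : Fin K → ℝ := fun k => if k ∈ J then 0 else 1 with hx
    set q : ℝ → Fin K → ℝ := fun t => x + t • N.faceVelocity J with hq
    have hqd : ∀ t, HasDerivAt q (N.faceVelocity J) t := fun t => by
      exact (((hasDerivAt_id t).smul_const (N.faceVelocity J)).const_add x).congr_deriv
        (one_smul ℝ _)
    have hev : ∀ᶠ t in nhds (0 : ℝ), ∀ k ∉ J, 0 < q t k := by
      rw [Filter.eventually_all]
      intro k
      by_cases hk : k ∈ J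
      · simp [hk]
      have hc : Continuous fun t => q t k := by
        simp only [hq, Pi.add_apply, Pi.smul_apply, smul_eq_mul]
        fun_prop
      have := hc.continuousAt.eventually (lt_mem_nhds
        (show (0 : ℝ) < q 0 k by simp [hq, hx, hk]))
      filter_upwards [this] with t ht _ using ht
    obtain ⟨ε, hε, hball⟩ := Metric.eventually_nhds_iff.1 hev
    refine ⟨0, ε / 2, q, by positivity, ?_, fun t ht => ⟨fun k hk => ?_, ?_⟩, ?_⟩
    · refine ContDiffOn.absolutelyContinuousOnInterval (ContDiff.contDiffOn ?_)
      exact contDiff_const.add (contDiff_id.smul contDiff_const)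
    · simp [hq, hx, hk, faceVelocity_of_mem hν hk]
    · refine hball ?_
      rw [Real.dist_eq, sub_zero, abs_of_nonneg ht.1]
      linarith [ht.2]
    · refine Filter.Eventually.of_forall fun t => ?_
      rw [(hqd t).deriv]
      exact isSubgradient_faceVelocity hν hμ hJ

end JacksonNetwork

/-! ### Absolutely continuous functions -/

lemma AbsolutelyContinuousOnInterval.of_dist_le {X Y : Type*} [PseudoMetricSpace X]
    [PseudoMetricSpace Y] {f : ℝ → X} {g : ℝ → Y} {a b C : ℝ}
    (hf : AbsolutelyContinuousOnInterval f a b)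
    (h : ∀ s ∈ Set.uIcc a b, ∀ t ∈ Set.uIcc a b, dist (g s) (g t) ≤ C * dist (f s) (f t)) :
    AbsolutelyContinuousOnInterval g a b := by
  rw [absolutelyContinuousOnInterval_iff] at hf ⊢
  intro ε hε
  have hC : 0 < |C| + 1 := by positivity
  obtain ⟨δ, hδ, H⟩ := hf (ε / (|C| + 1)) (by positivity)
  refine ⟨δ, hδ, fun E hE hEδ => ?_⟩
  have h1 := H E hE hEδ
  rw [lt_div_iff₀ hC, Finset.sum_mul] at h1
  refine lt_of_le_of_lt (Finset.sum_le_sum fun i hi => ?_) h1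
  refine (h _ (hE.1 i hi).1 _ (hE.1 i hi).2).trans ?_
  rw [mul_comm]
  refine mul_le_mul_of_nonneg_left ?_ dist_nonneg
  linarith [le_abs_self C]

lemma AbsolutelyContinuousOnInterval.congr_on {X : Type*} [PseudoMetricSpace X] {f g : ℝ → X}
    {a b : ℝ} (hf : AbsolutelyContinuousOnInterval f a b) (h : Set.EqOn f g (Set.uIcc a b)) :
    AbsolutelyContinuousOnInterval g a b :=
  hf.of_dist_le (C := 1) fun s hs t ht => by rw [h hs, h ht, one_mul]

lemma LipschitzWith.comp_absolutelyContinuousOnInterval {X Y : Type*} [PseudoMetricSpace X]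
    [PseudoMetricSpace Y] {F : X → Y} {C : NNReal} (hF : LipschitzWith C F) {f : ℝ → X} {a b : ℝ}
    (hf : AbsolutelyContinuousOnInterval f a b) :
    AbsolutelyContinuousOnInterval (fun t => F (f t)) a b :=
  hf.of_dist_le (C := C) fun _ _ _ _ => hF.dist_le_mul _ _

lemma AbsolutelyContinuousOnInterval.apply {K : ℕ} {q : ℝ → Fin K → ℝ} {a b : ℝ}
    (hq : AbsolutelyContinuousOnInterval q a b) (k : Fin K) :
    AbsolutelyContinuousOnInterval (fun t => q t k) a b :=
  hq.of_dist_le (C := 1) fun s _ t _ => by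
    rw [one_mul]
    exact dist_le_pi_dist (q s) (q t) k

lemma AbsolutelyContinuousOnInterval.comp_const_sub {X : Type*} [PseudoMetricSpace X]
    {f : ℝ → X} {T : ℝ} (hf : AbsolutelyContinuousOnInterval f 0 T) :
    AbsolutelyContinuousOnInterval (fun t => f (T - t)) 0 T := by
  rw [absolutelyContinuousOnInterval_iff] at hf ⊢
  intro ε hε
  obtain ⟨δ, hδ, H⟩ := hf ε hε
  refine ⟨δ, hδ, fun E hE hEδ => ?_⟩
  have hmem : ∀ {t : ℝ}, t ∈ Set.uIcc 0 T → T - t ∈ Set.uIcc 0 T := by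
    intro t ht
    rw [Set.mem_uIcc] at ht ⊢
    rcases ht with ht | ht
    · exact Or.inl ⟨by linarith, by linarith⟩
    · exact Or.inr ⟨by linarith, by linarith⟩
  refine H ⟨E.1, fun i => (T - (E.2 i).1, T - (E.2 i).2)⟩
    ⟨fun i hi => ⟨hmem (hE.1 i hi).1, hmem (hE.1 i hi).2⟩, fun i hi j hj hij => ?_⟩ ?_
  · have h1 : Disjoint (Set.uIoc (E.2 i).1 (E.2 i).2) (Set.uIoc (E.2 j).1 (E.2 j).2) :=
      hE.2 hi hj hij
    change Disjoint (Set.uIoc (T - (E.2 i).1) (T - (E.2 i).2))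
      (Set.uIoc (T - (E.2 j).1) (T - (E.2 j).2))
    simp only [Set.uIoc, Set.Ioc_disjoint_Ioc, min_sub_sub_left, max_sub_sub_left] at h1 ⊢
    linarith
  · have hd : ∀ x y : ℝ, dist (T - x) (T - y) = dist x y := fun x y => dist_sub_left T x y
    simpa only [hd] using hEδ

lemma AbsolutelyContinuousOnInterval.ae_hasDerivAt {K : ℕ} {q : ℝ → Fin K → ℝ} {a b : ℝ}
    (hq : AbsolutelyContinuousOnInterval q a b) :
    ∀ᵐ t : ℝ, t ∈ Set.uIcc a b → HasDerivAt q (deriv q t) t := by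
  have h := ae_all_iff.2 fun k => (hq.apply k).ae_differentiableAt
  filter_upwards [h] with t ht hmem
  exact (differentiableAt_pi.2 fun k => ht k hmem).hasDerivAt

lemma AbsolutelyContinuousOnInterval.sub_le_of_deriv_le {W : ℝ → ℝ} {a b c : ℝ} (hab : a ≤ b)
    (hW : AbsolutelyContinuousOnInterval W a b)
    (h : ∀ᵐ t : ℝ, t ∈ Set.Ioo a b → ∀ d, HasDerivAt W d t → d ≤ c) :
    W b - W a ≤ c * (b - a) := by
  rw [← hW.integral_deriv_eq_sub]
  have h2 : ∫ _ in a..b, c = c * (b - a) := by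
    rw [intervalIntegral.integral_const, smul_eq_mul, mul_comm]
  rw [← h2]
  refine intervalIntegral.integral_mono_ae_restrict hab hW.intervalIntegrable_deriv
    intervalIntegrable_const ?_
  rw [← restrict_Ioo_eq_restrict_Icc]
  refine (ae_restrict_iff' measurableSet_Ioo).2 ?_
  filter_upwards [h, hW.ae_differentiableAt] with t h3 h4 ht
  refine h3 ht _ (h4 ?_).hasDerivAt
  rw [Set.uIcc_of_le hab]
  exact Set.Ioo_subset_Icc_self ht

lemma hasDerivAt_zero_of_nonneg {f : ℝ → ℝ} {d t : ℝ} (hf : ∀ᶠ s in nhds t, 0 ≤ f s)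
    (h0 : f t = 0) (hd : HasDerivAt f d t) : d = 0 :=
  IsLocalMin.hasDerivAt_eq_zero (by filter_upwards [hf] with s hs; rwa [h0]) hd

lemma hasDerivAt_zero_of_abs {u : ℝ → ℝ} {t : ℝ} (h0 : u t = 0)
    (hd : HasDerivAt (fun s => |u s|) 0 t) : HasDerivAt u 0 t := by
  rw [hasDerivAt_iff_isLittleO] at hd ⊢
  simp only [h0, abs_zero, sub_zero, smul_zero] at hd ⊢
  exact (Asymptotics.isLittleO_abs_left.1 hd)

/-- The face that contains a point of the orthant. -/
lemma exists_mem_face {K : ℕ} {x : Fin K → ℝ} (hx : ∀ k, 0 ≤ x k) :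
    ∃ J : Finset (Fin K), x ∈ face J :=
  ⟨Finset.univ.filter fun k => x k = 0, fun i hi => by simpa using hi, fun i hi =>
    lt_of_le_of_ne (hx i) (Ne.symm (by simpa using hi))⟩

lemma eq_of_mem_face {K : ℕ} {x : Fin K → ℝ} {J J' : Finset (Fin K)} (h : x ∈ face J)
    (h' : x ∈ face J') : J = J' := by
  ext k
  constructor
  · intro hk
    by_contra hk'
    exact (h'.2 k hk').ne' (h.1 k hk)
  · intro hk
    by_contra hk'
    exact (h.2 k hk').ne' (h'.1 k hk)

namespace JacksonNetwork

variable {K : ℕ} (N : JacksonNetwork K)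

/-- The time reversals of the optimal paths: absolutely continuous trajectories in the orthant
which run through admissible faces only, with the reversed velocities. -/
def IsReversedFlow (q : ℝ → Fin K → ℝ) (T : ℝ) : Prop :=
  AbsolutelyContinuousOnInterval q 0 T ∧ (∀ t ∈ Set.Icc 0 T, ∀ k, 0 ≤ q t k) ∧
    ∀ᵐ t : ℝ, t ∈ Set.Ioo 0 T → ∀ J, q t ∈ face J →
      N.IsAdmissible J ∧ HasDerivAt q (-N.faceVelocity J) t

variable {N}

lemma IsReversedFlow.mono {q : ℝ → Fin K → ℝ} {S T : ℝ} (hq : N.IsReversedFlow q T) (hS : 0 ≤ S)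
    (hST : S ≤ T) : N.IsReversedFlow q S := by
  obtain ⟨h1, h2, h3⟩ := hq
  refine ⟨h1.mono ?_, fun t ht => h2 t ⟨ht.1, ht.2.trans hST⟩, ?_⟩
  · rw [Set.uIcc_of_le hS, Set.uIcc_of_le (hS.trans hST)]
    exact Set.Icc_subset_Icc_right hST
  · filter_upwards [h3] with t ht hmem
    exact ht ⟨hmem.1, hmem.2.trans_le hST⟩

lemma isAdmissible_univ (hν : ∀ k, 0 < N.nu k) (hμ : ∀ k, N.nu k < N.mu k) :
    N.IsAdmissible Finset.univ := fun l _ => by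
  rw [faceExcess_univ hν]
  simpa using (hμ l).le

lemma faceVelocity_univ (hν : ∀ k, 0 < N.nu k) : N.faceVelocity Finset.univ = 0 :=
  funext fun k => faceVelocity_of_mem hν (Finset.mem_univ k)

lemma isReversedFlow_zero (hν : ∀ k, 0 < N.nu k) (hμ : ∀ k, N.nu k < N.mu k) (T : ℝ) :
    N.IsReversedFlow (fun _ => 0) T := by
  refine ⟨?_, fun t _ k => le_rfl, Filter.Eventually.of_forall fun t _ J hJ => ?_⟩
  · exact (LipschitzWith.const (0 : Fin K → ℝ)).lipschitzOnWith.absolutelyContinuousOnInterval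
  · obtain rfl : J = Finset.univ :=
      eq_of_mem_face hJ ⟨fun _ _ => rfl, fun i hi => absurd (Finset.mem_univ i) hi⟩
    refine ⟨isAdmissible_univ hν hμ, ?_⟩
    rw [faceVelocity_univ hν, neg_zero]
    exact hasDerivAt_const t _

lemma IsAdmissible.faceExcess_le (hν : ∀ k, 0 < N.nu k) {J : Finset (Fin K)}
    (hJ : N.IsAdmissible J) (k : Fin K) : N.faceExcess J k ≤ N.mu k / N.nu k - 1 := by
  by_cases hk : k ∈ J
  · rw [le_sub_iff_add_le, le_div_iff₀ (hν k)]
    linarith [hJ k hk]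
  · exact ((isFaceExcess_faceExcess hν J).1 k hk).le

/-- Reversed flows do not expand the `ℓ¹` distance. -/
lemma IsReversedFlow.sum_abs_sub_le (hν : ∀ k, 0 < N.nu k)
    {q q' : ℝ → Fin K → ℝ} {S T : ℝ} (hS : 0 ≤ S) (hST : S ≤ T) (hq : N.IsReversedFlow q T)
    (hq' : N.IsReversedFlow q' T) : ∑ k, |q T k - q' T k| ≤ ∑ k, |q S k - q' S k| := by
  have hT := hS.trans hST
  have hac : ∀ k, AbsolutelyContinuousOnInterval (fun t => |q t k - q' t k|) 0 T := fun k =>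
    ((hq.1.apply k).sub (hq'.1.apply k)).of_dist_le (C := 1) fun s _ t _ => by
      rw [one_mul]
      exact abs_abs_sub_abs_le_abs_sub _ _
  have hacs : AbsolutelyContinuousOnInterval (fun t => ∑ k, |q t k - q' t k|) 0 T := by
    refine (hq.1.sub hq'.1).of_dist_le (C := K) fun s _ t _ => ?_
    refine (abs_sub_comm _ _).trans_le ?_
    rw [← Finset.sum_sub_distrib]
    refine (Finset.abs_sum_le_sum_abs _ _).trans ?_
    refine (Finset.sum_le_card_nsmul _ _ (dist ((q - q') s) ((q - q') t)) fun k _ => ?_).trans_eq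
      (by simp)
    refine (abs_abs_sub_abs_le_abs_sub _ _).trans ?_
    rw [abs_sub_comm]
    exact dist_le_pi_dist ((q - q') s) ((q - q') t) k
  have hd := ae_all_iff.2 fun k => (hac k).ae_differentiableAt
  have hsub : Set.uIcc S T ⊆ Set.uIcc 0 T := by
    rw [Set.uIcc_of_le hST, Set.uIcc_of_le hT]
    exact Set.Icc_subset_Icc_left hS
  have key := (hacs.mono hsub).sub_le_of_deriv_le (c := 0) hST ?_
  · linarith
  filter_upwards [hq.2.2, hq'.2.2, hd] with t h1 h2 h3 htS d hWd
  have ht : t ∈ Set.Ioo 0 T := ⟨hS.trans_lt htS.1, htS.2⟩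
  have htI : t ∈ Set.Icc 0 T := Set.Ioo_subset_Icc_self ht
  obtain ⟨J, hJ⟩ := exists_mem_face (hq.2.1 t htI)
  obtain ⟨J', hJ'⟩ := exists_mem_face (hq'.2.1 t htI)
  obtain ⟨a1, d1⟩ := h1 ht J hJ
  obtain ⟨a2, d2⟩ := h2 ht J' hJ'
  set y : Fin K → ℝ := N.faceExcess J' - N.faceExcess J with hy
  have hu : ∀ k, HasDerivAt (fun s => q s k - q' s k) (N.nu k * N.resid y k) t := fun k => by
    refine ((hasDerivAt_pi.1 d1 k).sub (hasDerivAt_pi.1 d2 k)).congr_deriv ?_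
    simp only [Pi.neg_apply, faceVelocity, hy, resid_sub]
    ring
  have habs : ∀ k, |∑ l, N.P k l * y l| ≤ ∑ l, N.P k l * |y l| := fun k =>
    (Finset.abs_sum_le_sum_abs _ _).trans_eq (Finset.sum_congr rfl fun l _ => by
      rw [abs_mul, abs_of_nonneg (N.P_nonneg k l)])
  have hdk : ∀ k, deriv (fun s => |q s k - q' s k|) t ≤
      -(N.nu k * N.resid (fun l => |y l|) k) := by
    intro k
    have hdiff := (h3 k (by rwa [Set.uIcc_of_le hT])).hasDerivAt
    have hb := abs_le.1 (habs k)
    rw [← mul_neg]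
    rcases lt_trichotomy (q t k - q' t k) 0 with hneg | h0 | hpos
    · have hk : k ∉ J' := fun hk => by
        have := hq.2.1 t htI k
        have := hJ'.1 k hk
        linarith
      have hyk : 0 ≤ y k := by
        have := a1.faceExcess_le hν k
        rw [← (isFaceExcess_faceExcess hν J').1 k hk] at this
        simpa [hy] using this
      have hcomp := (hasDerivAt_abs_neg hneg).comp t (hu k)
      have hdd : HasDerivAt (fun s => |q s k - q' s k|) (-1 * (N.nu k * N.resid y k)) t := hcomp
      rw [hdd.deriv, neg_one_mul, ← mul_neg]
      refine mul_le_mul_of_nonneg_left ?_ (hν k).le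
      rw [resid, resid, abs_of_nonneg hyk]
      linarith
    · have hz := hasDerivAt_zero_of_nonneg (Filter.Eventually.of_forall fun s => abs_nonneg _)
        (by rw [h0, abs_zero]) hdiff
      rw [hz] at hdiff ⊢
      have hz2 := (hasDerivAt_zero_of_abs (u := fun s => q s k - q' s k) h0 hdiff).unique (hu k)
      have hz3 : N.resid y k = 0 := (mul_eq_zero.1 hz2.symm).resolve_left (hν k).ne'
      refine mul_nonneg (hν k).le ?_
      rw [resid, sub_eq_zero] at hz3
      rw [resid, hz3]
      linarith [habs k]
    · have hk : k ∉ J := fun hk => by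
        have := hq'.2.1 t htI k
        have := hJ.1 k hk
        linarith
      have hyk : y k ≤ 0 := by
        have := a2.faceExcess_le hν k
        rw [← (isFaceExcess_faceExcess hν J).1 k hk] at this
        simpa [hy] using this
      have hcomp := (hasDerivAt_abs_pos hpos).comp t (hu k)
      have hdd : HasDerivAt (fun s => |q s k - q' s k|) (1 * (N.nu k * N.resid y k)) t := hcomp
      rw [hdd.deriv, one_mul]
      refine mul_le_mul_of_nonneg_left ?_ (hν k).le
      rw [resid, resid, abs_of_nonpos hyk]
      linarith
  have hsum : HasDerivAt (fun s => ∑ k, |q s k - q' s k|)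
      (∑ k, deriv (fun s => |q s k - q' s k|) t) t :=
    HasDerivAt.fun_sum fun k _ => (h3 k (by rwa [Set.uIcc_of_le hT])).hasDerivAt
  rw [hWd.unique hsum]
  refine (Finset.sum_le_sum fun k _ => hdk k).trans ?_
  rw [Finset.sum_neg_distrib, N.sum_nu_mul_resid, neg_nonpos]
  exact Finset.sum_nonneg fun k _ => mul_nonneg (N.lam_pos k).le (abs_nonneg _)

lemma IsReversedFlow.eqOn (hν : ∀ k, 0 < N.nu k) {q q' : ℝ → Fin K → ℝ} {T : ℝ}
    (hq : N.IsReversedFlow q T) (hq' : N.IsReversedFlow q' T) (h0 : q 0 = q' 0) :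
    Set.EqOn q q' (Set.Icc 0 T) := by
  intro t ht
  have h1 := (hq.mono ht.1 ht.2).sum_abs_sub_le hν le_rfl ht.1 (hq'.mono ht.1 ht.2)
  simp only [h0, sub_self, abs_zero, Finset.sum_const_zero] at h1
  funext k
  have h2 := (Finset.sum_eq_zero_iff_of_nonneg fun k _ => abs_nonneg _).1
    (le_antisymm h1 (Finset.sum_nonneg fun k _ => abs_nonneg _)) k (Finset.mem_univ k)
  rwa [abs_eq_zero, sub_eq_zero] at h2

lemma IsReversedFlow.eq_zero_of_eq_zero (hν : ∀ k, 0 < N.nu k) (hμ : ∀ k, N.nu k < N.mu k)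
    {q : ℝ → Fin K → ℝ} {S T : ℝ} (hS : 0 ≤ S) (hST : S ≤ T) (hq : N.IsReversedFlow q T)
    (h0 : q S = 0) : q T = 0 := by
  have h1 := hq.sum_abs_sub_le hν hS hST (isReversedFlow_zero hν hμ T)
  simp only [h0, Pi.zero_apply, sub_zero, abs_zero, Finset.sum_const_zero] at h1
  funext k
  have h2 := (Finset.sum_eq_zero_iff_of_nonneg fun k _ => abs_nonneg _).1
    (le_antisymm h1 (Finset.sum_nonneg fun k _ => abs_nonneg _)) k (Finset.mem_univ k)
  simpa using h2

/-- The time that a reversed flow needs to reach the origin. -/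
lemma IsReversedFlow.mul_le_sum (hν : ∀ k, 0 < N.nu k) (hμ : ∀ k, N.nu k < N.mu k)
    {q : ℝ → Fin K → ℝ} {T ε : ℝ} (hT : 0 ≤ T) (hq : N.IsReversedFlow q T)
    (hε : ∀ k, ε ≤ N.lam k * (N.mu k / N.nu k - 1)) (hne : ∀ t ∈ Set.Icc 0 T, q t ≠ 0) :
    ε * T ≤ ∑ k, q 0 k := by
  have hac : AbsolutelyContinuousOnInterval (fun t => ∑ k, q t k) 0 T := by
    refine hq.1.of_dist_le (C := K) fun s _ t _ => ?_
    rw [Real.dist_eq, ← Finset.sum_sub_distrib]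
    refine (Finset.abs_sum_le_sum_abs _ _).trans ?_
    exact (Finset.sum_le_card_nsmul _ _ (dist (q s) (q t)) fun k _ =>
      dist_le_pi_dist (q s) (q t) k).trans_eq (by simp)
  have key := hac.sub_le_of_deriv_le (c := -ε) hT ?_
  · have := Finset.sum_nonneg fun k (_ : k ∈ Finset.univ) => hq.2.1 T ⟨hT, le_rfl⟩ k
    rw [sub_zero] at key
    linarith
  filter_upwards [hq.2.2] with t h1 ht d hd
  have htI : t ∈ Set.Icc 0 T := Set.Ioo_subset_Icc_self ht
  obtain ⟨J, hJ⟩ := exists_mem_face (hq.2.1 t htI)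
  have h2 : HasDerivAt (fun s => ∑ k, q s k) (∑ k, -N.faceVelocity J k) t :=
    HasDerivAt.fun_sum fun k _ => hasDerivAt_pi.1 (h1 ht J hJ).2 k
  rw [hd.unique h2, Finset.sum_neg_distrib, neg_le_neg_iff]
  simp only [faceVelocity]
  rw [N.sum_nu_mul_resid]
  obtain ⟨k, hk⟩ : ∃ k, k ∉ J := by
    by_contra hcon
    push Not at hcon
    exact hne t htI (funext fun k => hJ.1 k (hcon k))
  refine (hε k).trans ?_
  rw [← (isFaceExcess_faceExcess hν J).1 k hk]
  exact Finset.single_le_sum (f := fun k => N.lam k * N.faceExcess J k)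
    (fun l _ => mul_nonneg (N.lam_pos l).le (faceExcess_nonneg hν hμ J l)) (Finset.mem_univ k)

/-! ### Fluid trajectories of the dual network -/

lemma one_sub_dualP_transpose_mulVec (hν : ∀ k, 0 < N.nu k) (s : Fin K → ℝ) (k : Fin K) :
    ((1 - N.dualPᵀ) *ᵥ s) k = N.nu k * N.resid (fun l => s l / N.nu l) k := by
  rw [Matrix.sub_mulVec, Matrix.one_mulVec, Pi.sub_apply, resid, mul_sub,
    mul_div_cancel₀ _ (hν k).ne', Finset.mul_sum]
  congr 1
  simp only [Matrix.mulVec, dotProduct, Matrix.transpose_apply, dualP, Matrix.of_apply]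
  exact Finset.sum_congr rfl fun l _ => by ring

lemma dualLam_eq (k : Fin K) : N.dualLam k = N.nu k * N.resid (fun _ => 1) k := by
  simp [dualLam, resid]

lemma dualDrift_eq (hν : ∀ k, 0 < N.nu k) (k : Fin K) :
    (N.dualLam - (1 - N.dualPᵀ) *ᵥ N.mu : Fin K → ℝ) k =
      -(N.nu k * N.resid (fun l => N.mu l / N.nu l - 1) k) := by
  have h1 : (fun l => N.mu l / N.nu l - 1) = (fun l => N.mu l / N.nu l) - fun _ => (1 : ℝ) := rfl
  rw [Pi.sub_apply, one_sub_dualP_transpose_mulVec hν, dualLam_eq, h1, resid_sub]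
  ring

lemma IsDualFluid.apply_zero {r : Fin K → ℝ} {q : ℝ → Fin K → ℝ} (hq : N.IsDualFluid r q) :
    q 0 = r := by
  obtain ⟨φ, hφ0, -, -, hq, -⟩ := hq
  rw [hq 0 le_rfl, hφ0, zero_smul, Matrix.mulVec_zero, add_zero, add_zero]

lemma IsDualFluid.isReversedFlow (hν : ∀ k, 0 < N.nu k) {r : Fin K → ℝ} {q : ℝ → Fin K → ℝ}
    (hq : N.IsDualFluid r q) {T : ℝ} (hT : 0 ≤ T) : N.IsReversedFlow q T := by
  obtain ⟨φ, hφ0, hmono, hac, hform, hnn, hcomp⟩ := hq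
  set v : Fin K → ℝ := N.dualLam - (1 - N.dualPᵀ) *ᵥ N.mu with hv
  set L : (Fin K → ℝ) →L[ℝ] (Fin K → ℝ) :=
    LinearMap.toContinuousLinearMap (Matrix.mulVecLin (1 - N.dualPᵀ)) with hL
  have hLa : ∀ x, L x = (1 - N.dualPᵀ) *ᵥ x := fun x => rfl
  have hsm : ContDiff ℝ 1 fun t : ℝ => r + t • v :=
    contDiff_const.add (contDiff_id.smul contDiff_const)
  refine ⟨?_, fun t ht => hnn t ht.1, ?_⟩
  · have h1 := (hsm.contDiffOn.absolutelyContinuousOnInterval (a := 0) (b := T)).add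
      (L.lipschitz.comp_absolutelyContinuousOnInterval (hac T hT))
    refine h1.congr_on fun t ht => ?_
    rw [Set.uIcc_of_le hT] at ht
    rw [hform t ht.1, Pi.add_apply, hLa]
  have hc := ae_all_iff.2 hcomp
  filter_upwards [(hac T hT).ae_hasDerivAt, hc] with t h1 h2 ht J hJ
  have hφd := h1 (by rw [Set.uIcc_of_le hT]; exact Set.Ioo_subset_Icc_self ht)
  set φ' := deriv φ t with hφ'
  have hφk : ∀ k, HasDerivAt (fun s => φ s k) (φ' k) t := hasDerivAt_pi.1 hφd
  have hpos : ∀ᶠ s in nhds t, 0 ≤ s := by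
    filter_upwards [lt_mem_nhds ht.1] with s hs using hs.le
  have hqd : HasDerivAt q (v + L φ') t := by
    have h3 : HasDerivAt (fun s => r + s • v + L (φ s)) (v + L φ') t := by
      refine HasDerivAt.add ?_ (L.hasFDerivAt.comp_hasDerivAt t hφd)
      exact (((hasDerivAt_id t).smul_const v).const_add r).congr_deriv (one_smul ℝ _)
    refine h3.congr_of_eventuallyEq ?_
    filter_upwards [hpos] with s hs
    rw [hform s hs, hLa]
  have hφnn : ∀ k, 0 ≤ φ' k := fun k => by
    refine (hφk k).hasDerivWithinAt.nonneg_of_monotoneOn (s := Set.Ici 0)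
      ((uniqueDiffOn_Ici (0 : ℝ)) t ht.1.le).accPt ?_
    exact fun s hs s' hs' hss => hmono hs hs' hss k
  have hqk : ∀ k, (v + L φ') k = -(N.nu k *
      N.resid (fun l => (N.mu l - φ' l) / N.nu l - 1) k) := by
    intro k
    have h3 : (fun l => (N.mu l - φ' l) / N.nu l - 1) =
        (fun l => N.mu l / N.nu l - 1) - fun l => φ' l / N.nu l := by
      funext l
      simp only [Pi.sub_apply]
      ring
    rw [Pi.add_apply, hLa, hv, dualDrift_eq hν, one_sub_dualP_transpose_mulVec hν, h3, resid_sub]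
    ring
  have hx : (fun l => (N.mu l - φ' l) / N.nu l - 1) = N.faceExcess J := by
    refine IsFaceExcess.eq hν ⟨fun k hk => ?_, fun k hk => ?_⟩
    · have h3 := h2 k ht.1.le
      rw [(hφk k).deriv] at h3
      simp only [(mul_eq_zero.1 h3).resolve_left (hJ.2 k hk).ne', sub_zero]
    · have h3 := hasDerivAt_zero_of_nonneg
        (by filter_upwards [hpos] with s hs using hnn s hs k) (hJ.1 k hk) (hasDerivAt_pi.1 hqd k)
      rw [hqk, neg_eq_zero] at h3
      exact (mul_eq_zero.1 h3).resolve_left (hν k).ne'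
  refine ⟨fun l hl => ?_, hqd.congr_deriv (funext fun k => ?_)⟩
  · have h3 := congrFun hx l
    rw [← h3, add_sub_cancel, mul_div_cancel₀ _ (hν l).ne']
    linarith [hφnn l]
  · rw [hqk, hx, Pi.neg_apply, faceVelocity]

variable (N)

/-- Feasible regulators: nonnegative nondecreasing `φ` such that `x + (I - P) (φ t - t b)` stays
in the orthant. -/
def IsFeasible (x b : Fin K → ℝ) (φ : ℝ → Fin K → ℝ) : Prop :=
  (∀ t, 0 ≤ t → ∀ k, 0 ≤ φ t k) ∧ (∀ s t, 0 ≤ s → s ≤ t → ∀ k, φ s k ≤ φ t k) ∧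
    ∀ t, 0 ≤ t → ∀ k, ∑ l, N.P k l * φ t l ≤ φ t k + x k - t * N.resid b k

/-- The least feasible regulator. -/
def regulator (x b : Fin K → ℝ) (t : ℝ) (k : Fin K) : ℝ :=
  sInf ((fun φ : ℝ → Fin K → ℝ => φ t k) '' {φ | N.IsFeasible x b φ})

variable {N} {x b : Fin K → ℝ}

lemma isFeasible_linear (hx : ∀ k, 0 ≤ x k) (hb : ∀ k, 0 ≤ b k) :
    N.IsFeasible x b fun t => t • b := by
  refine ⟨fun t ht k => mul_nonneg ht (hb k), fun s t _ hst k =>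
    mul_le_mul_of_nonneg_right hst (hb k), fun t _ k => ?_⟩
  have h1 := N.resid_smul t b k
  rw [resid] at h1
  simp only [Pi.smul_apply, smul_eq_mul] at h1 ⊢
  linarith [hx k]

lemma regulator_le {φ : ℝ → Fin K → ℝ} (hφ : N.IsFeasible x b φ) {t : ℝ} (ht : 0 ≤ t)
    (k : Fin K) : N.regulator x b t k ≤ φ t k :=
  csInf_le ⟨0, by rintro _ ⟨ψ, hψ, rfl⟩; exact hψ.1 t ht k⟩ ⟨φ, hφ, rfl⟩

lemma le_regulator (hx : ∀ k, 0 ≤ x k) (hb : ∀ k, 0 ≤ b k) {t c : ℝ} {k : Fin K}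
    (h : ∀ φ, N.IsFeasible x b φ → c ≤ φ t k) : c ≤ N.regulator x b t k :=
  le_csInf ⟨_, _, isFeasible_linear hx hb, rfl⟩ (by rintro _ ⟨ψ, hψ, rfl⟩; exact h ψ hψ)

lemma isFeasible_regulator (hx : ∀ k, 0 ≤ x k) (hb : ∀ k, 0 ≤ b k) :
    N.IsFeasible x b (N.regulator x b) := by
  refine ⟨fun t ht k => le_regulator hx hb fun φ hφ => hφ.1 t ht k, fun s t hs hst k =>
    le_regulator hx hb fun φ hφ => (regulator_le hφ hs k).trans (hφ.2.1 s t hs hst k),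
    fun t ht k => ?_⟩
  have h1 : ∑ l, N.P k l * N.regulator x b t l - x k + t * N.resid b k ≤ N.regulator x b t k := by
    refine le_regulator hx hb fun φ hφ => ?_
    have h2 : ∑ l, N.P k l * N.regulator x b t l ≤ ∑ l, N.P k l * φ t l :=
      Finset.sum_le_sum fun l _ =>
        mul_le_mul_of_nonneg_left (regulator_le hφ ht l) (N.P_nonneg k l)
    linarith [hφ.2.2 t ht k]
  linarith

lemma regulator_zero (hx : ∀ k, 0 ≤ x k) (hb : ∀ k, 0 ≤ b k) : N.regulator x b 0 = 0 := by
  funext k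
  refine le_antisymm ?_ ((isFeasible_regulator hx hb).1 0 le_rfl k)
  simpa using regulator_le (isFeasible_linear (N := N) hx hb) le_rfl k

lemma regulator_le_add (hx : ∀ k, 0 ≤ x k) (hb : ∀ k, 0 ≤ b k) {s t : ℝ} (hs : 0 ≤ s)
    (hst : s ≤ t) (k : Fin K) :
    N.regulator x b t k ≤ N.regulator x b s k + (t - s) * b k := by
  obtain ⟨f1, f2, f3⟩ := isFeasible_regulator (N := N) hx hb
  have key : N.IsFeasible x b fun τ => if τ ≤ s then N.regulator x b τ
      else N.regulator x b s + (τ - s) • b := by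
    refine ⟨fun τ hτ k => ?_, fun τ τ' hτ hττ k => ?_, fun τ hτ k => ?_⟩
    · dsimp only
      split_ifs with h
      · exact f1 τ hτ k
      · exact add_nonneg (f1 s hs k) (mul_nonneg (sub_nonneg.2 (not_le.1 h).le) (hb k))
    · dsimp only
      split_ifs with h h' h'
      · exact f2 τ τ' hτ hττ k
      · exact (f2 τ s hτ h k).trans (le_add_of_nonneg_right
          (mul_nonneg (sub_nonneg.2 (not_le.1 h').le) (hb k)))
      · exact absurd (hττ.trans h') h
      · exact add_le_add le_rfl (mul_le_mul_of_nonneg_right (by linarith) (hb k))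
    · dsimp only
      split_ifs with h
      · exact f3 τ hτ k
      · have h1 := f3 s hs k
        have h2 := N.resid_smul (τ - s) b k
        rw [resid] at h2
        simp only [Pi.smul_apply, smul_eq_mul, Pi.add_apply, mul_add,
          Finset.sum_add_distrib] at h2 ⊢
        linarith
  have h1 := regulator_le key (hs.trans hst) k
  split_ifs at h1 with h
  · obtain rfl := le_antisymm h hst
    simp
  · exact h1

/-- The regulator does not grow while the regulated coordinate is positive. -/
lemma regulator_eq_of_pos (hx : ∀ k, 0 ≤ x k) (hb : ∀ k, 0 ≤ b k) {a c δ : ℝ} (ha : 0 ≤ a)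
    (hac : a ≤ c) (hδ : 0 < δ) {k : Fin K}
    (h : ∀ τ ∈ Set.Icc a c, ∑ l, N.P k l * N.regulator x b τ l + δ ≤
      N.regulator x b τ k + x k - τ * N.resid b k) :
    N.regulator x b c k = N.regulator x b a k := by
  obtain ⟨f1, f2, f3⟩ := isFeasible_regulator (N := N) hx hb
  set φ := N.regulator x b with hφ
  set ψ : ℝ → Fin K → ℝ := fun τ j =>
    if j = k ∧ a ≤ τ ∧ τ ≤ c then max (φ a k) (φ τ k - δ) else φ τ j with hψ
  have hψφ : ∀ τ j, ψ τ j ≤ φ τ j := by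
    intro τ j
    simp only [hψ]
    split_ifs with h1
    · obtain ⟨rfl, h2, -⟩ := h1
      exact max_le (f2 a τ ha h2 j) (by linarith)
    · exact le_rfl
  have key : N.IsFeasible x b ψ := by
    refine ⟨fun τ hτ j => ?_, fun τ τ' hτ hττ j => ?_, fun τ hτ j => ?_⟩
    · simp only [hψ]
      split_ifs with h1
      · exact (f1 a ha k).trans (le_max_left _ _)
      · exact f1 τ hτ j
    · by_cases h1 : j = k ∧ a ≤ τ' ∧ τ' ≤ c
      · obtain ⟨rfl, h2, h3⟩ := h1
        have e1 : ψ τ' j = max (φ a j) (φ τ' j - δ) := by simp [hψ, h2, h3]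
        rw [e1]
        by_cases h4 : a ≤ τ
        · have e2 : ψ τ j = max (φ a j) (φ τ j - δ) := by simp [hψ, h4, hττ.trans h3]
          rw [e2]
          exact max_le_max le_rfl (sub_le_sub_right (f2 τ τ' hτ hττ j) _)
        · exact ((hψφ τ j).trans (f2 τ a hτ (not_le.1 h4).le j)).trans (le_max_left _ _)
      · have e1 : ψ τ' j = φ τ' j := by simp only [hψ, if_neg h1]
        rw [e1]
        exact (hψφ τ j).trans (f2 τ τ' hτ hττ j)
    · have h1 : ∑ l, N.P j l * ψ τ l ≤ ∑ l, N.P j l * φ τ l :=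
        Finset.sum_le_sum fun l _ => mul_le_mul_of_nonneg_left (hψφ τ l) (N.P_nonneg j l)
      by_cases h2 : j = k ∧ a ≤ τ ∧ τ ≤ c
      · obtain ⟨rfl, h3, h4⟩ := h2
        have e1 : ψ τ j = max (φ a j) (φ τ j - δ) := by simp [hψ, h3, h4]
        have h5 := h τ ⟨h3, h4⟩
        have h6 := le_max_right (φ a j) (φ τ j - δ)
        rw [e1]
        linarith
      · have e1 : ψ τ j = φ τ j := by simp only [hψ, if_neg h2]
        rw [e1]
        exact h1.trans (f3 τ hτ j)
  refine le_antisymm ?_ (f2 a c ha hac k)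
  have h1 : φ c k ≤ ψ c k := regulator_le key (ha.trans hac) k
  have e1 : ψ c k = max (φ a k) (φ c k - δ) := by simp [hψ, hac]
  rw [e1] at h1
  rcases le_max_iff.1 h1 with h2 | h2
  · exact h2
  · linarith

lemma lipschitzOnWith_regulator (hx : ∀ k, 0 ≤ x k) (hb : ∀ k, 0 ≤ b k) :
    LipschitzOnWith (∑ k, b k).toNNReal (N.regulator x b) (Set.Ici 0) := by
  have hB : 0 ≤ ∑ k, b k := Finset.sum_nonneg fun k _ => hb k
  refine LipschitzOnWith.of_dist_le_mul fun s hs t ht => ?_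
  rw [Real.coe_toNNReal _ hB]
  wlog hst : s ≤ t generalizing s t
  · rw [dist_comm, dist_comm s]
    exact this t ht s hs (not_le.1 hst).le
  refine (dist_pi_le_iff (mul_nonneg hB dist_nonneg)).2 fun k => ?_
  have h1 := regulator_le_add (N := N) hx hb hs hst k
  have h2 := (isFeasible_regulator (N := N) hx hb).2.1 s t hs hst k
  have h3 := Finset.single_le_sum (fun k _ => hb k) (Finset.mem_univ k)
  rw [dist_comm, Real.dist_eq, abs_of_nonneg (by linarith), dist_comm, Real.dist_eq,
    abs_of_nonneg (by linarith)]
  have h4 := mul_le_mul_of_nonneg_right h3 (sub_nonneg.2 hst)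
  linarith

lemma deriv_regulator_eq_zero (hx : ∀ k, 0 ≤ x k) (hb : ∀ k, 0 ≤ b k) {t : ℝ} (ht : 0 < t)
    {k : Fin K} (hpos : ∑ l, N.P k l * N.regulator x b t l <
      N.regulator x b t k + x k - t * N.resid b k) :
    deriv (fun s => N.regulator x b s k) t = 0 := by
  have hcont : ContinuousAt (N.regulator x b) t :=
    (lipschitzOnWith_regulator hx hb).continuousOn.continuousAt (Ici_mem_nhds ht)
  have hck : ∀ l, ContinuousAt (fun s => N.regulator x b s l) t := continuousAt_pi.1 hcont
  obtain ⟨δ, hδ, hδ'⟩ : ∃ δ > 0, ∑ l, N.P k l * N.regulator x b t l + δ <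
      N.regulator x b t k + x k - t * N.resid b k :=
    ⟨(N.regulator x b t k + x k - t * N.resid b k - ∑ l, N.P k l * N.regulator x b t l) / 2,
      by linarith, by linarith⟩
  have h1 : ContinuousAt (fun s => ∑ l, N.P k l * N.regulator x b s l + δ) t :=
    (tendsto_finsetSum _ fun l _ => (hck l).const_mul _).add tendsto_const_nhds
  have h2 : ContinuousAt (fun s => N.regulator x b s k + x k - s * N.resid b k) t :=
    ((hck k).add continuousAt_const).sub (continuousAt_id.mul continuousAt_const)
  obtain ⟨ε, hε, hball⟩ := Metric.eventually_nhds_iff.1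
    ((h1.eventually_lt h2 hδ').and (lt_mem_nhds ht))
  have hconst : (fun s => N.regulator x b s k) =ᶠ[nhds t] fun _ => N.regulator x b t k := by
    have hin : ∀ {s τ : ℝ}, |s - t| < ε → |τ - t| ≤ |s - t| →
        ∑ l, N.P k l * N.regulator x b τ l + δ ≤ N.regulator x b τ k + x k - τ * N.resid b k :=
      fun hs hτ => (hball (lt_of_le_of_lt hτ hs)).1.le
    filter_upwards [Metric.ball_mem_nhds t hε] with s hs
    rw [Metric.mem_ball, Real.dist_eq] at hs
    have hs0 : 0 < s := (hball (by rwa [Real.dist_eq])).2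
    rcases le_total s t with hst | hst
    · refine (regulator_eq_of_pos hx hb hs0.le hst hδ fun τ hτ => hin hs ?_).symm
      rw [abs_of_nonpos (by linarith [hτ.2]), abs_of_nonpos (by linarith)]
      linarith [hτ.1]
    · refine regulator_eq_of_pos hx hb ht.le hst hδ fun τ hτ => hin hs ?_
      rw [abs_of_nonneg (by linarith [hτ.1]), abs_of_nonneg (by linarith)]
      linarith [hτ.2]
  rw [hconst.deriv_eq, deriv_const]

lemma exists_isDualFluid (hν : ∀ k, 0 < N.nu k) (hμ : ∀ k, N.nu k < N.mu k) {r : Fin K → ℝ}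
    (hr : ∀ k, 0 ≤ r k) : ∃ q, N.IsDualFluid r q := by
  set x : Fin K → ℝ := fun k => r k / N.nu k with hx'
  set b : Fin K → ℝ := fun k => N.mu k / N.nu k - 1 with hb'
  have hx : ∀ k, 0 ≤ x k := fun k => div_nonneg (hr k) (hν k).le
  have hb : ∀ k, 0 ≤ b k := fun k => (load_inv_sub_one_pos hν hμ k).le
  set φ := N.regulator x b with hφ
  obtain ⟨f1, f2, f3⟩ := isFeasible_regulator (N := N) hx hb
  have hform : ∀ t k, (r + t • (N.dualLam - (1 - N.dualPᵀ) *ᵥ N.mu) +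
      (1 - N.dualPᵀ) *ᵥ (fun k => N.nu k * φ t k) : Fin K → ℝ) k =
      N.nu k * (φ t k + x k - t * N.resid b k - ∑ l, N.P k l * φ t l) := by
    intro t k
    have h1 := dualDrift_eq hν k
    have h2 : (fun l => N.nu l * φ t l / N.nu l) = φ t :=
      funext fun l => mul_div_cancel_left₀ _ (hν l).ne'
    have h3 : r k = N.nu k * x k := (mul_div_cancel₀ _ (hν k).ne').symm
    rw [Pi.add_apply, Pi.add_apply, Pi.smul_apply, smul_eq_mul, h1,
      one_sub_dualP_transpose_mulVec hν, h2, h3]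
    simp only [resid]
    ring
  refine ⟨fun t => r + t • (N.dualLam - (1 - N.dualPᵀ) *ᵥ N.mu) +
      (1 - N.dualPᵀ) *ᵥ (fun k => N.nu k * φ t k), fun t k => N.nu k * φ t k, ?_, ?_, ?_, ?_,
      ?_, ?_⟩
  · funext k
    simp [hφ, regulator_zero hx hb]
  · exact fun s hs t _ hst k => mul_le_mul_of_nonneg_left (f2 s t hs hst k) (hν k).le
  · intro T hT
    have h1 : AbsolutelyContinuousOnInterval φ 0 T := by
      refine ((lipschitzOnWith_regulator hx hb).mono ?_).absolutelyContinuousOnInterval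
      rw [Set.uIcc_of_le hT]
      exact Set.Icc_subset_Ici_self
    have h0 : ∀ k ∈ Finset.univ, 0 ≤ N.nu k := fun k _ => (hν k).le
    refine h1.of_dist_le (C := ∑ k, N.nu k) fun s _ t _ => ?_
    refine (dist_pi_le_iff (mul_nonneg (Finset.sum_nonneg h0) dist_nonneg)).2 fun k => ?_
    rw [Real.dist_eq, ← mul_sub, abs_mul, abs_of_pos (hν k)]
    exact mul_le_mul (Finset.single_le_sum h0 (Finset.mem_univ k))
      (dist_le_pi_dist (φ s) (φ t) k) (abs_nonneg _) (Finset.sum_nonneg h0)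
  · exact fun t _ => rfl
  · intro t ht k
    dsimp only
    rw [hform]
    exact mul_nonneg (hν k).le (sub_nonneg.2 (f3 t ht k))
  · intro k
    have h0 : ∀ᵐ t : ℝ, t ≠ 0 := by simp [ae_iff, measure_singleton]
    filter_upwards [h0] with t ht0 ht
    rw [hform, deriv_const_mul_field]
    rcases (f3 t ht k).eq_or_lt with h1 | h1
    · rw [h1, sub_self]
      simp
    · rw [deriv_regulator_eq_zero hx hb (lt_of_le_of_ne ht ht0.symm) h1]
      simp

variable (N)

lemma lagrangian_eq_of_mem_face {x : Fin K → ℝ} {J : Finset (Fin K)} (hx : x ∈ face J)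
    (y : Fin K → ℝ) : N.lagrangian x y = N.lagrangianOn J y := by
  rw [lagrangian, Finset.sum_eq_single J, Set.indicator_of_mem hx]
  · intro J' _ hJ'
    exact Set.indicator_of_notMem (fun h => hJ' (eq_of_mem_face h hx)) _
  · simp

/-- The vector `θ^*`. -/
def logLoads (k : Fin K) : ℝ := -Real.log (N.rho k)

/-- The trajectory `q` runs through admissible faces with the velocities of optimal paths. -/
def IsOptimalFlow (q : ℝ → Fin K → ℝ) (T : ℝ) : Prop :=
  ∀ᵐ t : ℝ, t ∈ Set.Ioo 0 T → ∀ J, q t ∈ face J →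
    N.IsAdmissible J ∧ HasDerivAt q (N.faceVelocity J) t

variable {N}

lemma ae_const_sub {p : ℝ → Prop} (hp : ∀ᵐ t : ℝ, p t) (T : ℝ) : ∀ᵐ t : ℝ, p (T - t) :=
  (Measure.measurePreserving_sub_left (volume : Measure ℝ) T).quasiMeasurePreserving.ae hp

lemma IsReversedFlow.isOptimalFlow {q q' : ℝ → Fin K → ℝ} {T : ℝ} (hq : N.IsReversedFlow q T)
    (h : ∀ t ∈ Set.Icc 0 T, q' t = q (T - t)) : N.IsOptimalFlow q' T := by
  filter_upwards [ae_const_sub hq.2.2 T] with t ht htI J hJ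
  rw [h t (Set.Ioo_subset_Icc_self htI)] at hJ
  obtain ⟨h1, h2⟩ := ht ⟨by linarith [htI.2], by linarith [htI.1]⟩ J hJ
  refine ⟨h1, ((h2.comp_const_sub T t).congr_of_eventuallyEq ?_).congr_deriv (neg_neg _)⟩
  filter_upwards [Ioo_mem_nhds htI.1 htI.2] with s hs
  exact h s (Set.Ioo_subset_Icc_self hs)

lemma IsOptimalFlow.isReversedFlow {q : ℝ → Fin K → ℝ} {T : ℝ} (hq : N.IsOptimalFlow q T)
    (hac : AbsolutelyContinuousOnInterval q 0 T) (hnn : ∀ t ∈ Set.Icc 0 T, ∀ k, 0 ≤ q t k) :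
    N.IsReversedFlow (fun t => q (T - t)) T := by
  refine ⟨hac.comp_const_sub, fun t ht => hnn _ ⟨by linarith [ht.2], by linarith [ht.1]⟩, ?_⟩
  filter_upwards [ae_const_sub hq T] with t ht htI J hJ
  obtain ⟨h1, h2⟩ := ht ⟨by linarith [htI.2], by linarith [htI.1]⟩ J hJ
  exact ⟨h1, h2.comp_const_sub T t⟩

lemma continuous_ham (J : Finset (Fin K)) : Continuous (N.ham J) := by
  unfold ham h
  fun_prop

lemma measurableSet_face (J : Finset (Fin K)) : MeasurableSet (face J) := by
  have : face J = (⋂ i ∈ J, {x : Fin K → ℝ | x i = 0}) ∩ ⋂ i ∈ Jᶜ, {x : Fin K → ℝ | 0 < x i} := by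
    ext x
    simp [face]
  rw [this]
  exact (Finset.measurableSet_biInter _ fun i _ =>
    measurableSet_eq_fun (measurable_pi_apply i) measurable_const).inter
    (Finset.measurableSet_biInter _ fun i _ =>
      measurableSet_lt measurable_const (measurable_pi_apply i))

lemma logLoads_nonneg (hν : ∀ k, 0 < N.nu k) (hμ : ∀ k, N.nu k < N.mu k) (k : Fin K) :
    0 ≤ N.logLoads k :=
  neg_nonneg.2 (Real.log_nonpos (div_pos (hν k) (N.mu_pos k)).le
    ((div_le_one (N.mu_pos k)).2 (hμ k).le))

lemma faceMomentum_dotProduct (hν : ∀ k, 0 < N.nu k) {J : Finset (Fin K)} {v : Fin K → ℝ}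
    (hv : ∀ k ∈ J, v k = 0) : N.faceMomentum J ⬝ᵥ v = N.logLoads ⬝ᵥ v := by
  refine Finset.sum_congr rfl fun k _ => ?_
  by_cases hk : k ∈ J
  · rw [hv k hk, mul_zero, mul_zero]
  · rw [faceMomentum_of_notMem hν hk, logLoads]

section Path

variable {r : Fin K → ℝ} {T : ℝ} {q : ℝ → Fin K → ℝ}

lemma _root_.IsPathTo.ae_tangent (hq : IsPathTo r T q) :
    ∀ᵐ t ∂(volume.restrict (Set.Icc 0 T)), t ∈ Set.Ioo 0 T ∧ HasDerivAt q (deriv q t) t ∧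
      ∃ J, q t ∈ face J ∧ ∀ k ∈ J, deriv q t k = 0 := by
  obtain ⟨hT, hac, -, -, hnn⟩ := hq
  rw [← restrict_Ioo_eq_restrict_Icc]
  refine (ae_restrict_iff' measurableSet_Ioo).2 ?_
  filter_upwards [hac.ae_hasDerivAt] with t ht htI
  have htd := ht (by rw [Set.uIcc_of_le hT]; exact Set.Ioo_subset_Icc_self htI)
  obtain ⟨J, hJ⟩ := exists_mem_face (hnn t (Set.Ioo_subset_Icc_self htI))
  refine ⟨htI, htd, J, hJ, fun k hk => ?_⟩
  refine hasDerivAt_zero_of_nonneg ?_ (hJ.1 k hk) (hasDerivAt_pi.1 htd k)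
  filter_upwards [Ioo_mem_nhds htI.1 htI.2] with s hs
  exact hnn s (Set.Ioo_subset_Icc_self hs) k

lemma _root_.IsPathTo.integral_dotProduct_deriv (hq : IsPathTo r T q) (θ : Fin K → ℝ) :
    Integrable (fun t => θ ⬝ᵥ deriv q t) (volume.restrict (Set.Icc 0 T)) ∧
      ∫ t in Set.Icc 0 T, θ ⬝ᵥ deriv q t = θ ⬝ᵥ r := by
  have ⟨hT, hac, h0, hr, _⟩ := hq
  set L : (Fin K → ℝ) →L[ℝ] ℝ := LinearMap.toContinuousLinearMap (dotProductBilin ℝ ℝ θ) with hL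
  have hLa : ∀ x, L x = θ ⬝ᵥ x := fun x => rfl
  have hf := L.lipschitz.comp_absolutelyContinuousOnInterval hac
  have hae : (deriv fun t => L (q t)) =ᵐ[volume.restrict (Set.Icc 0 T)]
      fun t => θ ⬝ᵥ deriv q t := by
    filter_upwards [hq.ae_tangent] with t ht
    have h1 : HasDerivAt (fun t => L (q t)) (L (deriv q t)) t :=
      L.hasFDerivAt.comp_hasDerivAt t ht.2.1
    rw [h1.deriv, hLa]
  have hint := hf.intervalIntegrable_deriv
  rw [intervalIntegrable_iff_integrableOn_Icc_of_le hT] at hint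
  refine ⟨hint.congr hae, ?_⟩
  rw [← integral_congr_ae hae, integral_Icc_eq_integral_Ioc,
    ← intervalIntegral.integral_of_le hT, hf.integral_deriv_eq_sub, h0, hr, map_zero, sub_zero, hLa]

lemma _root_.IsPathTo.ofReal_le_pathCost (hν : ∀ k, 0 < N.nu k) (hμ : ∀ k, N.nu k < N.mu k)
    (hq : IsPathTo r T q) :
    ENNReal.ofReal (N.logLoads ⬝ᵥ r) ≤
        ∫⁻ t in Set.Icc 0 T, ENNReal.ofReal (N.logLoads ⬝ᵥ deriv q t) ∧
      ∫⁻ t in Set.Icc 0 T, ENNReal.ofReal (N.logLoads ⬝ᵥ deriv q t) ≤ N.pathCost T q := by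
  obtain ⟨hint, heq⟩ := hq.integral_dotProduct_deriv N.logLoads
  constructor
  · rw [← heq]
    refine ENNReal.ofReal_le_of_le_toReal ?_
    rw [integral_eq_lintegral_pos_part_sub_lintegral_neg_part hint]
    linarith [ENNReal.toReal_nonneg
      (a := ∫⁻ t in Set.Icc 0 T, ENNReal.ofReal (-(N.logLoads ⬝ᵥ deriv q t)))]
  · refine lintegral_mono_ae ?_
    filter_upwards [hq.ae_tangent] with t ⟨_, _, J, hJ, hd⟩
    rw [N.lagrangian_eq_of_mem_face hJ, ← faceMomentum_dotProduct hν hd]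
    have := N.ofReal_le_lagrangianOn J (N.faceMomentum J) (deriv q t)
    rwa [ham_faceMomentum hν hμ, sub_zero] at this

lemma _root_.IsPathTo.pathCost_eq_of_isOptimalFlow (hν : ∀ k, 0 < N.nu k) (hμ : ∀ k, N.nu k < N.mu k)
    (hq : IsPathTo r T q) (hflow : N.IsOptimalFlow q T) :
    N.pathCost T q = ENNReal.ofReal (N.logLoads ⬝ᵥ r) := by
  obtain ⟨hint, heq⟩ := hq.integral_dotProduct_deriv N.logLoads
  have hae : ∀ᵐ t ∂(volume.restrict (Set.Icc 0 T)), 0 ≤ N.logLoads ⬝ᵥ deriv q t ∧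
      N.lagrangian (q t) (deriv q t) = ENNReal.ofReal (N.logLoads ⬝ᵥ deriv q t) := by
    filter_upwards [hq.ae_tangent, ae_restrict_of_ae hflow] with t ⟨htI, _, J, hJ, hd⟩ ht
    obtain ⟨h1, h2⟩ := ht htI J hJ
    obtain ⟨h3, h4⟩ := lagrangianOn_faceVelocity hν hμ h1
    rw [N.lagrangian_eq_of_mem_face hJ, ← faceMomentum_dotProduct hν hd, h2.deriv]
    exact ⟨h3, h4⟩
  rw [pathCost, lintegral_congr_ae (hae.mono fun t ht => ht.2), ← heq,
    ofReal_integral_eq_lintegral_ofReal hint (hae.mono fun t ht => ht.1)]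

lemma _root_.IsPathTo.isOptimalFlow_of_pathCost_eq (hν : ∀ k, 0 < N.nu k) (hμ : ∀ k, N.nu k < N.mu k)
    (hr : ∀ k, 0 ≤ r k) (hq : IsPathTo r T q)
    (hcost : N.pathCost T q = ENNReal.ofReal (N.logLoads ⬝ᵥ r)) : N.IsOptimalFlow q T := by
  set μ := (volume.restrict (Set.Icc 0 T) : Measure ℝ) with hμ'
  obtain ⟨hint, heq⟩ := hq.integral_dotProduct_deriv N.logLoads
  obtain ⟨hle1, hle2⟩ := hq.ofReal_le_pathCost hν hμ
  have hr0 : 0 ≤ N.logLoads ⬝ᵥ r :=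
    Finset.sum_nonneg fun k _ => mul_nonneg (logLoads_nonneg hν hμ k) (hr k)
  have hmeas : ∀ θ : Fin K → ℝ, AEMeasurable (fun t => θ ⬝ᵥ deriv q t) μ := fun θ =>
    (hq.integral_dotProduct_deriv θ).1.aemeasurable
  set A := ∫⁻ t, ENNReal.ofReal (N.logLoads ⬝ᵥ deriv q t) ∂μ with hA
  have hAeq : A = ENNReal.ofReal (N.logLoads ⬝ᵥ r) := le_antisymm (hle2.trans_eq hcost) hle1
  have hpos : ∀ᵐ t ∂μ, 0 ≤ N.logLoads ⬝ᵥ deriv q t := by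
    have h1 := integral_eq_lintegral_pos_part_sub_lintegral_neg_part hint
    rw [heq, ← hA, hAeq, ENNReal.toReal_ofReal hr0] at h1
    have h2 : (∫⁻ t, ENNReal.ofReal (-(N.logLoads ⬝ᵥ deriv q t)) ∂μ).toReal = 0 := by linarith
    have h3 : ∫⁻ t, ENNReal.ofReal (-(N.logLoads ⬝ᵥ deriv q t)) ∂μ ≠ ⊤ :=
      hint.neg.lintegral_lt_top.ne
    have h4 := ((ENNReal.toReal_eq_zero_iff _).1 h2).resolve_right h3
    have h5 : AEMeasurable (fun t => -(N.logLoads ⬝ᵥ deriv q t)) μ := (hmeas _).neg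
    rw [lintegral_eq_zero_iff' h5.ennreal_ofReal] at h4
    filter_upwards [h4] with t ht
    simpa using ht
  have hface : ∀ (J : Finset (Fin K)) (θ : Fin K → ℝ), ∀ᵐ t ∂μ, q t ∈ face J →
      θ ⬝ᵥ deriv q t - N.ham J θ ≤ N.logLoads ⬝ᵥ deriv q t := by
    intro J θ
    have hqm : AEMeasurable q μ := by
      have := hq.2.1.continuousOn
      rw [Set.uIcc_of_le hq.1] at this
      exact this.aemeasurable measurableSet_Icc
    have hS : NullMeasurableSet (q ⁻¹' face J) μ :=
      hqm.nullMeasurableSet_preimage (measurableSet_face J)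
    set G : ℝ → ℝ≥0∞ := (q ⁻¹' face J).indicator
      fun t => ENNReal.ofReal (θ ⬝ᵥ deriv q t - N.ham J θ) with hG
    have hGm : AEMeasurable G μ := ((hmeas θ).sub_const _).ennreal_ofReal.indicator₀ hS
    have hFm : AEMeasurable (fun t => ENNReal.ofReal (N.logLoads ⬝ᵥ deriv q t)) μ :=
      (hmeas _).ennreal_ofReal
    have hmax : ∫⁻ t, max (ENNReal.ofReal (N.logLoads ⬝ᵥ deriv q t)) (G t) ∂μ ≤ A := by
      rw [hAeq, ← hcost, pathCost]
      refine lintegral_mono_ae ?_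
      filter_upwards [hq.ae_tangent] with t ⟨_, _, J', hJ', hd⟩
      rw [N.lagrangian_eq_of_mem_face hJ']
      refine max_le ?_ ?_
      · rw [← faceMomentum_dotProduct hν hd]
        have := N.ofReal_le_lagrangianOn J' (N.faceMomentum J') (deriv q t)
        rwa [ham_faceMomentum hν hμ, sub_zero] at this
      · by_cases hJ : q t ∈ face J
        · rw [hG, Set.indicator_of_mem (show t ∈ q ⁻¹' face J from hJ), eq_of_mem_face hJ hJ']
          exact N.ofReal_le_lagrangianOn J' θ (deriv q t)
        · rw [hG, Set.indicator_of_notMem (show t ∉ q ⁻¹' face J from hJ)]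
          exact zero_le
    have hae := ae_eq_of_ae_le_of_lintegral_le
      (Filter.Eventually.of_forall fun t => le_max_left _ (G t))
      (by rw [← hA, hAeq]; exact ENNReal.ofReal_ne_top) (hFm.max hGm) hmax
    filter_upwards [hae, hpos] with t ht ht0 hJ
    have h1 : G t ≤ ENNReal.ofReal (N.logLoads ⬝ᵥ deriv q t) := by
      rw [ht]
      exact le_max_right _ _
    rw [hG, Set.indicator_of_mem (show t ∈ q ⁻¹' face J from hJ)] at h1
    exact (ENNReal.ofReal_le_ofReal_iff ht0).1 h1
  have hall := ae_all_iff.2 fun J => ae_all_iff.2 fun n : ℕ =>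
    hface J (TopologicalSpace.denseSeq (Fin K → ℝ) n)
  have hmain := hq.ae_tangent.and hall
  rw [← restrict_Ioo_eq_restrict_Icc, ae_restrict_iff' measurableSet_Ioo] at hmain
  filter_upwards [hmain] with t ht htI J hJ
  obtain ⟨⟨-, hd, J', hJ', hd0⟩, hsub⟩ := ht htI
  obtain rfl := eq_of_mem_face hJ hJ'
  have hsub' : ∀ θ : Fin K → ℝ, θ ⬝ᵥ deriv q t - N.ham J θ ≤ N.logLoads ⬝ᵥ deriv q t := by
    refine fun θ => (TopologicalSpace.denseRange_denseSeq (Fin K → ℝ)).induction_on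
      (p := fun θ => θ ⬝ᵥ deriv q t - N.ham J θ ≤ N.logLoads ⬝ᵥ deriv q t) θ ?_
      fun n => hsub J n hJ
    refine isClosed_le (Continuous.sub ?_ (continuous_ham J)) continuous_const
    unfold dotProduct
    fun_prop
  obtain ⟨h1, h2⟩ := eq_faceVelocity_of_le_ham hν hμ hd0 fun θ => by
    rw [dotProduct_comm, sub_dotProduct, faceMomentum_dotProduct hν hd0]
    linarith [hsub' θ]
  exact ⟨h2, h1 ▸ hd⟩

end Path

lemma IsDualFluid.exists_isLeast_zero (hν : ∀ k, 0 < N.nu k) (hμ : ∀ k, N.nu k < N.mu k)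
    {r : Fin K → ℝ} {q : ℝ → Fin K → ℝ} (hq : N.IsDualFluid r q) :
    ∃ T, IsLeast {t : ℝ | 0 ≤ t ∧ q t = 0} T := by
  obtain ⟨ε, hε, hε'⟩ : ∃ ε > 0, ∀ k, ε ≤ N.lam k * (N.mu k / N.nu k - 1) := by
    have hpos : ∀ k, 0 < N.lam k * (N.mu k / N.nu k - 1) := fun k =>
      mul_pos (N.lam_pos k) (load_inv_sub_one_pos hν hμ k)
    have hev : ∀ᶠ ε in nhdsWithin (0 : ℝ) (Set.Ioi 0),
        ∀ k, ε ≤ N.lam k * (N.mu k / N.nu k - 1) :=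
      Filter.eventually_all.2 fun k =>
        ((gt_mem_nhds (hpos k)).filter_mono nhdsWithin_le_nhds).mono fun ε hε => hε.le
    obtain ⟨ε, h1, h2⟩ := (hev.and self_mem_nhdsWithin).exists
    exact ⟨ε, h2, h1⟩
  obtain ⟨S, hS, hS0⟩ : ∃ S, 0 ≤ S ∧ q S = 0 := by
    by_contra hcon
    push Not at hcon
    have hT : 0 ≤ (|∑ k, q 0 k| + 1) / ε := by positivity
    have h1 := (hq.isReversedFlow hν hT).mul_le_sum hν hμ hT hε' fun t ht => hcon t ht.1
    rw [mul_div_cancel₀ _ hε.ne'] at h1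
    linarith [le_abs_self (∑ k, q 0 k)]
  have hcont : ContinuousOn q (Set.Icc 0 S) := by
    have := (hq.isReversedFlow hν hS).1.continuousOn
    rwa [Set.uIcc_of_le hS] at this
  have hcomp : IsCompact (Set.Icc 0 S ∩ q ⁻¹' {0}) :=
    isCompact_Icc.of_isClosed_subset
      (hcont.preimage_isClosed_of_isClosed isClosed_Icc isClosed_singleton) Set.inter_subset_left
  obtain ⟨T, hT, hmin⟩ := hcomp.exists_isLeast ⟨S, ⟨hS, le_rfl⟩, hS0⟩
  refine ⟨T, ⟨hT.1.1, hT.2⟩, fun t ht => ?_⟩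
  rcases le_total t S with h | h
  · exact hmin ⟨⟨ht.1, h⟩, ht.2⟩
  · exact hT.1.2.trans h

end JacksonNetwork

end

open JacksonNetwork in
theorem theorem3p1 {K : ℕ} (N : JacksonNetwork K) (hN : N.IsErgodic) :
    ∃ (θax : Fin K → Fin K → ℝ) (θstar : Fin K → ℝ) (θface : Finset (Fin K) → Fin K → ℝ),
      -- `θax m` is the vector `θ^(m)`, `θstar` is `θ^*`, and `θface J` is `θ̃^(J)`
      (∀ m θ, N.IsAxisMomentum m θ ↔ θ = θax m) ∧
      (∀ m, θstar m = θax m m) ∧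
      (∀ J θ, N.IsFaceMomentum θstar J θ ↔ θ = θface J) ∧
      (∀ J, N.hamiltonianOn J (θface J) = 0) ∧
      -- the essential faces
      (∀ J, N.IsEssentialFace J (θface J) ↔ ∀ l ∈ J, N.rho l ≤ Real.exp (-θface J l)) ∧
      ∀ r : Fin K → ℝ, (∀ k, 0 ≤ r k) →
        ∃ (qbar : ℝ → Fin K → ℝ) (Tstar : ℝ) (qstar : ℝ → Fin K → ℝ),
          -- the dual fluid trajectory from `r`, the time at which it reaches the origin, and
          -- its reversal in time
          N.IsDualFluid r qbar ∧
          (∀ q, N.IsDualFluid r q → Set.EqOn q qbar (Set.Ici 0)) ∧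
          IsLeast {t : ℝ | 0 ≤ t ∧ qbar t = 0} Tstar ∧
          (∀ t, qstar t = qbar (Tstar - t)) ∧
          -- `qstar` leads from the origin to `r` at the cost `θ^* · r`
          IsPathTo r Tstar qstar ∧
          ((N.pathCost Tstar qstar : ℝ≥0∞) : EReal) = ((θstar ⬝ᵥ r : ℝ) : EReal) ∧
          -- it moves in essential faces, with the momenta `θ̃^(J)`
          (∀ᵐ t ∂(volume.restrict (Set.Icc 0 Tstar)), ∀ J, qstar t ∈ face J →
            N.IsEssentialFace J (θface J) ∧
            IsSubgradient (N.hamiltonianOn J) (θface J) (deriv qstar t)) ∧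
          -- it is optimal, and unique up to time spent at the origin
          (∀ T q, IsPathTo r T q → N.pathCost Tstar qstar ≤ N.pathCost T q) ∧
          (∀ T q, IsPathTo r T q →
            (N.pathCost T q = N.pathCost Tstar qstar ↔
              Tstar ≤ T ∧ (∀ t ∈ Set.Icc 0 (T - Tstar), q t = 0) ∧
              ∀ t ∈ Set.Icc (T - Tstar) T, q t = qstar (t - (T - Tstar)))) := by
  have hν : ∀ k, 0 < N.nu k := fun k => (hN.nu_pos_and_lt k).1
  have hμ : ∀ k, N.nu k < N.mu k := fun k => (hN.nu_pos_and_lt k).2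
  refine ⟨fun m => N.faceMomentum {m}ᶜ, N.logLoads, N.faceMomentum, isAxisMomentum_iff hν hμ,
    fun m => (faceMomentum_of_notMem hν (by simp)).symm, isFaceMomentum_iff hν hμ,
    hamiltonianOn_faceMomentum hν hμ, fun J => ?_, fun r hr => ?_⟩
  · rw [isEssentialFace_iff hν hμ, rho_le_exp_iff_isAdmissible hν hμ]
  obtain ⟨qbar, hqbar⟩ := exists_isDualFluid hν hμ hr
  obtain ⟨Tstar, hTstar⟩ := hqbar.exists_isLeast_zero hν hμ
  have hT0 : 0 ≤ Tstar := hTstar.1.1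
  have hflow : ∀ {T : ℝ}, 0 ≤ T → N.IsReversedFlow qbar T := fun hT => hqbar.isReversedFlow hν hT
  have hzero : ∀ t, Tstar ≤ t → qbar t = 0 := fun t ht =>
    (hflow (hT0.trans ht)).eq_zero_of_eq_zero hν hμ hT0 ht hTstar.1.2
  have hpath : IsPathTo r Tstar fun t => qbar (Tstar - t) := by
    refine ⟨hT0, (hflow hT0).1.comp_const_sub, ?_, ?_, fun t ht => ?_⟩
    · simpa using hTstar.1.2
    · simpa using hqbar.apply_zero
    · exact (hflow hT0).2.1 _ ⟨by linarith [ht.2], by linarith [ht.1]⟩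
  have hopt : N.IsOptimalFlow (fun t => qbar (Tstar - t)) Tstar :=
    (hflow hT0).isOptimalFlow fun _ _ => rfl
  have hcost := hpath.pathCost_eq_of_isOptimalFlow hν hμ hopt
  have hr0 : 0 ≤ N.logLoads ⬝ᵥ r :=
    Finset.sum_nonneg fun k _ => mul_nonneg (logLoads_nonneg hν hμ k) (hr k)
  refine ⟨qbar, Tstar, fun t => qbar (Tstar - t), hqbar, fun q hq t ht => ?_, hTstar,
    fun _ => rfl, hpath, ?_, ?_, fun T q hq => ?_, fun T q hq => ⟨fun h => ?_, ?_⟩⟩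
  · exact (hq.isReversedFlow hν ht).eqOn hν (hflow ht)
      (by rw [hq.apply_zero, hqbar.apply_zero]) ⟨ht, le_rfl⟩
  · rw [hcost, EReal.coe_ennreal_ofReal, max_eq_left hr0]
  · filter_upwards [hpath.ae_tangent, ae_restrict_of_ae hopt] with t ht1 ht2 J hJ
    obtain ⟨h1, h2⟩ := ht2 ht1.1 J hJ
    rw [isEssentialFace_iff hν hμ, h2.deriv]
    exact ⟨h1, isSubgradient_faceVelocity hν hμ h1⟩
  · rw [hcost]
    obtain ⟨h1, h2⟩ := hq.ofReal_le_pathCost hν hμ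
    exact h1.trans h2
  · rw [hcost] at h
    have hrev := (hq.isOptimalFlow_of_pathCost_eq hν hμ hr h).isReversedFlow hq.2.1 hq.2.2.2.2
    obtain ⟨hT, -, h0, hqT, -⟩ := hq
    have heq : ∀ t ∈ Set.Icc 0 T, q t = qbar (T - t) := fun t ht => by
      have := hrev.eqOn hν (hflow hT) (by rw [sub_zero, hqT, hqbar.apply_zero])
        (show T - t ∈ Set.Icc 0 T from ⟨by linarith [ht.2], by linarith [ht.1]⟩)
      simpa using this
    have hle : Tstar ≤ T := by
      refine hTstar.2 ⟨hT, ?_⟩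
      have := heq 0 ⟨le_rfl, hT⟩
      rwa [sub_zero, h0, eq_comm] at this
    refine ⟨hle, fun t ht => ?_, fun t ht => ?_⟩
    · rw [heq t ⟨ht.1, by linarith [ht.2]⟩]
      exact hzero _ (by linarith [ht.2])
    · rw [heq t ⟨by linarith [ht.1], ht.2⟩]
      exact congrArg qbar (by ring)
  · rintro ⟨hle, h1, h2⟩
    rw [hcost]
    refine hq.pathCost_eq_of_isOptimalFlow hν hμ
      ((hflow (hT0.trans hle)).isOptimalFlow fun t ht => ?_)
    rcases le_total t (T - Tstar) with h | h
    · rw [h1 t ⟨ht.1, h⟩, hzero _ (by linarith)]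
    · rw [h2 t ⟨h, ht.2⟩]
      exact congrArg qbar (by ring)
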